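/- Let $E$ be a complex Hilbert space of finite dimension $N+1$ and let $m\ge 1$. (1) Let $\tilde H(s)$, $s\in[0,1]$, be self-adjoint operators on $E$, of class $C^{m+2}$ in $s$. Let $|j(s)\rangle$, $j=0,\dots,N$, be orthonormal instantaneous eigenstates, $\tilde H(s)|j(s)\rangle=\varepsilon_j(s)|j(s)\rangle$, differentiable in $s\in[0,1]$, with phases chosen so that $\langle j(s)|\frac{d}{ds}|j(s)\rangle=0$. Assume that the ground state $|0(s)\rangle$ is not degenerate, i.e. $\Delta_j(s)=\varepsilon_j(s)-\varepsilon_0(s)>0$ for all $j\ne0$ and $s\in[0,1]$, and that for any $j\neq k$ either $\varepsilon_j(s)\ne\varepsilon_k(s)$ for all $s\in[0,1]$, or the two levels are uncoupled, $\langle j(s)|\frac{d}{ds}|k(s)\rangle=0$ for all $s\in[0,1]$. Put $$A_j^{(m)}(s)=\frac{1}{\Delta_j(s)^{m+1}}\Big\langle j(s)\Big|\frac{d^m\tilde H(s)}{ds^m}\Big|0(s)\Big\rangle .$$ For $\tau>0$ let $|\tilde\psi_\tau(s)\rangle$ solve the real-time Schrödinger equation $i\frac{d}{ds}|\tilde\psi_\tau(s)\rangle=\tau\tilde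 H(s)|\tilde\psi_\tau(s)\rangle$ on $[0,1]$ (where $s=t/\tau$, $\hbar=1$) with $|\tilde\psi_\tau(0)\rangle=|0(0)\rangle$. If $\tilde H^{(k)}(0)=\tilde H^{(k)}(1)=0$ for $k=1,\dots,m-1$, then there are constants $C$ and $\tau_0>0$, independent of $\tau$, such that for all $\tau\ge\tau_0$ and all $j\ne0$ $$\big|\langle j(1)|\tilde\psi_\tau(1)\rangle\big|^2\le\frac{1}{\tau^{2m}}\Big[\big|A_j^{(m)}(0)\big|+\big|A_j^{(m)}(1)\big|\Big]^2+\frac{C}{\tau^{2m+1}} .$$ (2) Call $f:[0,1]\to\mathbb R$ a schedule of order $m$ if $f(0)=0$, $f(1)=1$, $f\in C^{m+1}([0,1])$, and $f^{(k)}(0)=f^{(k)}(1)=0$ for $k=1,\dots,m-1$. Let $H_{\rm pot},H_{\rm kin}$ be self-adjoint operators on $E$ and $f$ a schedule of order $m$ such that the lowest eigenvalue of $\tilde H(s)=f(s)H_{\rm pot}+(1-f(s))H_{\rm kin}$ is simple for every $s\in[0,1]$. If $|\tilde\psi_\tau(0)\rangle$ is a normalized ground state of $H_{\rm kin}$ and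 $|g\rangle$ is a normalized ground state of $H_{\rm pot}$, then the total excitation probability at the final time satisfies $1-|\langle g|\tilde\psi_\tau(1)\rangle|^2=O(\tau^{-2m})$ as $\tau\to\infty$. (3) The polynomials $s$, $s^2(3-2s)$, $s^3(10-15s+6s^2)$ and $s^4(35-84s+70s^2-20s^3)$ are schedules of order $m=1,2,3,4$ respectively; in particular $s^2(3-2s)$ reduces the error to order $\tau^{-4}$. -/

import Mathlib

open Set

noncomputable section

/-- `ψ` solves, in the dimensionless time `s = t / τ`, the real-time Schrödinger equation
`i ψ'(s) = τ H(s) ψ(s)` on `[0, 1]` (with `ℏ = 1`; one-sided derivatives at the end points). -/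
def IsSchrodingerSolution {E : Type*} [NormedAddCommGroup E] [InnerProductSpace ℂ E]
    (H : ℝ → E →L[ℂ] E) (τ : ℝ) (ψ : ℝ → E) : Prop :=
  ∀ s ∈ Icc (0 : ℝ) 1,
    HasDerivWithinAt ψ (-(Complex.I * (τ : ℂ)) • H s (ψ s)) (Icc 0 1) s

/-- `|j(s)⟩ = e j s`, `0 ≤ j ≤ N`, are instantaneous eigenstates of `H(s)` on `[0, 1]` with
energies `ε j s`; `e 0` is the ground state, and it is not degenerate. -/
structure IsInstantaneousEigenframe {E : Type*} [NormedAddCommGroup E] [InnerProductSpace ℂ E]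
    {N : ℕ} (H : ℝ → E →L[ℂ] E) (e : Fin (N + 1) → ℝ → E) (ε : Fin (N + 1) → ℝ → ℝ) : Prop where
  orthonormal : ∀ s ∈ Icc (0 : ℝ) 1, Orthonormal ℂ (fun j => e j s)
  eigen : ∀ s ∈ Icc (0 : ℝ) 1, ∀ j, H s (e j s) = (ε j s : ℂ) • e j s
  ground_lt : ∀ s ∈ Icc (0 : ℝ) 1, ∀ j, j ≠ 0 → ε 0 s < ε j s
  differentiable : ∀ j, DifferentiableOn ℝ (e j) (Icc 0 1)
  /-- the choice of phases `⟨j(s)| d/ds |j(s)⟩ = 0` -/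
  phase : ∀ s ∈ Icc (0 : ℝ) 1, ∀ j, inner ℂ (e j s) (derivWithin (e j) (Icc 0 1) s) = 0
  /-- two different levels never meet on `[0, 1]`, unless they are uncoupled throughout -/
  noncrossing : ∀ j k, j ≠ k →
    (∀ s ∈ Icc (0 : ℝ) 1, ε j s ≠ ε k s) ∨
    (∀ s ∈ Icc (0 : ℝ) 1, inner ℂ (e j s) (derivWithin (e k) (Icc 0 1) s) = 0)

/-- `A_j^{(m)}(s) = Δ_j(s)^{-(m+1)} ⟨j(s)| H^{(m)}(s) |0(s)⟩`, `Δ_j = ε_j - ε_0`. -/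
def excitationCoeff {E : Type*} [NormedAddCommGroup E] [InnerProductSpace ℂ E]
    {N : ℕ} (H : ℝ → E →L[ℂ] E) (e : Fin (N + 1) → ℝ → E) (ε : Fin (N + 1) → ℝ → ℝ)
    (m : ℕ) (j : Fin (N + 1)) (s : ℝ) : ℂ :=
  inner ℂ (e j s) (iteratedDerivWithin m H (Icc 0 1) s (e 0 s)) /
    (((ε j s - ε 0 s) ^ (m + 1) : ℝ) : ℂ)

/-- `μ` is the lowest eigenvalue of `T` (used for self-adjoint `T`, whose eigenvalues are real). -/
def IsGroundEnergy {E : Type*} [NormedAddCommGroup E] [InnerProductSpace ℂ E]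
    (T : E →L[ℂ] E) (μ : ℝ) : Prop :=
  Module.End.HasEigenvalue (T : E →ₗ[ℂ] E) (μ : ℂ) ∧
    ∀ ν : ℝ, Module.End.HasEigenvalue (T : E →ₗ[ℂ] E) (ν : ℂ) → μ ≤ ν

/-- The lowest eigenvalue of `T` is simple. -/
def HasNondegenerateGroundState {E : Type*} [NormedAddCommGroup E] [InnerProductSpace ℂ E]
    (T : E →L[ℂ] E) : Prop :=
  ∃ μ : ℝ, IsGroundEnergy T μ ∧
    Module.finrank ℂ (Module.End.eigenspace (T : E →ₗ[ℂ] E) (μ : ℂ)) = 1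

/-- `v` is a normalized ground state of `T`. -/
def IsGroundState {E : Type*} [NormedAddCommGroup E] [InnerProductSpace ℂ E]
    (T : E →L[ℂ] E) (v : E) : Prop :=
  ‖v‖ = 1 ∧ ∃ μ : ℝ, IsGroundEnergy T μ ∧ T v = (μ : ℂ) • v

/-- An annealing schedule from `0` to `1`, of class `C^{m+1}` on `[0, 1]`, whose derivatives of
orders `1, …, m - 1` vanish at both end points. -/
structure IsAnnealingSchedule (m : ℕ) (f : ℝ → ℝ) : Prop where
  zero : f 0 = 0
  one : f 1 = 1
  contDiffOn : ContDiffOn ℝ (m + 1 : ℕ) f (Icc 0 1)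
  deriv_zero : ∀ k, 1 ≤ k → k < m → iteratedDerivWithin k f (Icc 0 1) 0 = 0
  deriv_one : ∀ k, 1 ≤ k → k < m → iteratedDerivWithin k f (Icc 0 1) 1 = 0

/-- The annealing Hamiltonian `f(s) H_pot + (1 - f(s)) H_kin`. -/
def annealingHamiltonian {E : Type*} [NormedAddCommGroup E] [InnerProductSpace ℂ E]
    (f : ℝ → ℝ) (Hpot Hkin : E →L[ℂ] E) (s : ℝ) : E →L[ℂ] E :=
  (f s : ℂ) • Hpot + ((1 - f s : ℝ) : ℂ) • Hkin

end

/-!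
Let `e` be a normalized eigenvector of `H` for a simple eigenvalue `lam`, with the parallel phase
`⟨e, e'⟩ = 0`. Up to the dynamical phase `exp (-i τ ∫ lam)`, the Schrödinger equation has the formal
solution `∑ τ⁻ᵏ u k` with `u 0 = e` and `(H - lam) u (k + 1) = i (u k)'`. These equations are solved
by the reduced resolvent `R` of `H - lam`; the component of `u (k + 1)` along `e` is fixed, up to a
constant, by the solvability condition `⟨e, (u (k + 1))'⟩ = 0` of the next equation
(`IsParallelEigenvector.map_adiabaticCoeff_succ`). Each step costs one derivative of `H`. The sum
truncated after the order `n` satisfies the Schrödinger equation up to a source term of order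
`τ⁻ⁿ`, and since the evolution is unitary, it stays that close to the exact solution
(`IsForcedSolution.norm_le`).

If the derivatives of `H` of orders `1, …, m - 1` vanish at an end point, then there `u k` is a
multiple of `e` for `k < m`, and `u m = -iᵐ Rᵐ⁺¹ H⁽ᵐ⁾ e` modulo `e`
(`IsParallelEigenvector.exists_adiabaticCoeff_boundary`). This follows from `e' = -R H' e` by keeping
track of the order of vanishing in each step. Hence the truncated expansion deviates from a multiple
of `e` by `O(τ⁻ᵐ)` at both ends, which gives the bound `O(τ⁻²ᵐ)` on the total excitation probability
(`IsParallelEigenvector.exists_excitation_le`).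

For the sharp constant in the amplitude of one excited level `j`, the truncation is at the order
`m + 1`. The matrix elements of `u m` in the eigenvector `j` are the excitation coefficients at the
two ends. The one at `s = 1` appears directly. The one at `s = 0` enters through the initial
condition, as the difference of the solution and the truncated expansion starts with the value
`-τ⁻ᵐ u m`; the modulus of its component along `j` is conserved up to `O(τ⁻ᵐ⁻¹)`, by a first order
expansion at the level `j` (`exists_norm_inner_le`), for which the derivative of the eigenvector `j`
has to be in the range of `H - ε j`. This is what the noncrossing condition provides
(`IsInstantaneousEigenframe.exists_map_sub_eq_derivWithin`).

For an annealing Hamiltonian only the simplicity of the lowest eigenvalue is known. It depends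
continuously on `s` by the variational principle; the spectral projector and the reduced resolvent
are then continuous as well, the Feynman–Hellmann formula holds, and a parallel eigenvector is the
solution of the linear differential equation with Kato's skew-adjoint generator
(`exists_isParallelEigenvector`). Its regularity follows from `e' = -R H' e`.
-/

/-! ### Calculus on the unit interval -/

section Calculus

variable {F G K : Type*} [NormedAddCommGroup F] [NormedSpace ℝ F] [NormedAddCommGroup G]
  [NormedSpace ℝ G] [NormedAddCommGroup K] [NormedSpace ℝ K]

lemma uniqueDiffOn_unitInterval : UniqueDiffOn ℝ (Icc (0 : ℝ) 1) :=
  uniqueDiffOn_Icc zero_lt_one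

lemma derivWithin_unitInterval {f : ℝ → F} {f' : F} {s : ℝ} (hs : s ∈ Icc (0 : ℝ) 1)
    (h : HasDerivWithinAt f f' (Icc 0 1) s) : derivWithin f (Icc 0 1) s = f' :=
  h.derivWithin (uniqueDiffOn_unitInterval s hs)

lemma ContDiffOn.derivWithin_unitInterval {n : ℕ} {f : ℝ → F}
    (h : ContDiffOn ℝ (n + 1 : ℕ) f (Icc 0 1)) :
    ContDiffOn ℝ n (derivWithin f (Icc 0 1)) (Icc 0 1) :=
  h.derivWithin uniqueDiffOn_unitInterval (by norm_cast)

lemma ContDiffOn.hasDerivWithinAt_unitInterval {n : ℕ} {f : ℝ → F}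
    (h : ContDiffOn ℝ (n + 1 : ℕ) f (Icc 0 1)) {s : ℝ} (hs : s ∈ Icc (0 : ℝ) 1) :
    HasDerivWithinAt f (derivWithin f (Icc 0 1) s) (Icc 0 1) s :=
  ((h.differentiableOn (by simp)) s hs).hasDerivWithinAt

lemma contDiffOn_succ_of_hasDerivWithinAt {n : ℕ} {f f' : ℝ → F}
    (h : ∀ s ∈ Icc (0 : ℝ) 1, HasDerivWithinAt f (f' s) (Icc 0 1) s)
    (hf' : ContDiffOn ℝ n f' (Icc 0 1)) : ContDiffOn ℝ (n + 1 : ℕ) f (Icc 0 1) := by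
  push_cast
  rw [contDiffOn_succ_iff_derivWithin uniqueDiffOn_unitInterval]
  refine ⟨fun s hs => (h s hs).differentiableWithinAt, fun h => by simp at h, ?_⟩
  exact hf'.congr fun s hs => derivWithin_unitInterval hs (h s hs)

/-- The primitive of `g` on `[0, 1]` that vanishes at `0`. Outside `[0, 1]` the integrand is
extended by its values at the end points, which makes it continuous if `g` is on `[0, 1]`. -/
noncomputable def primitiveOn (g : ℝ → F) (s : ℝ) : F :=
  ∫ t in (0 : ℝ)..s, g (projIcc 0 1 zero_le_one t)

lemma primitiveOn_zero (g : ℝ → F) : primitiveOn g 0 = 0 := by simp [primitiveOn]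

lemma hasDerivWithinAt_primitiveOn [CompleteSpace F] {g : ℝ → F}
    (hg : ContinuousOn g (Icc 0 1)) {s : ℝ} (hs : s ∈ Icc (0 : ℝ) 1) :
    HasDerivWithinAt (primitiveOn g) (g s) (Icc 0 1) s := by
  have hc : Continuous fun t : ℝ => g (projIcc 0 1 zero_le_one t) :=
    (continuousOn_iff_continuous_domRestrict.1 hg).comp continuous_projIcc
  have := (intervalIntegral.integral_hasDerivAt_right (hc.intervalIntegrable 0 s)
    (hc.stronglyMeasurableAtFilter _ _) hc.continuousAt).hasDerivWithinAt (s := Icc 0 1)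
  rw [projIcc_of_mem zero_le_one hs] at this
  exact this

/-- `f` vanishes to order `p` at the point `b` of the unit interval: `f` and its derivatives
within `[0, 1]` of orders `< p` are zero at `b`. -/
def VanishesToOrder (b : ℝ) : ℕ → (ℝ → F) → Prop
  | 0, _ => True
  | p + 1, f => f b = 0 ∧ VanishesToOrder b p (derivWithin f (Icc 0 1))

namespace VanishesToOrder

variable {b : ℝ}

lemma of_iteratedDerivWithin {p : ℕ} {f : ℝ → F}
    (h : ∀ i < p, iteratedDerivWithin i f (Icc 0 1) b = 0) : VanishesToOrder b p f := by
  induction p generalizing f with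
  | zero => trivial
  | succ p ih =>
    refine ⟨by simpa using h 0 (by omega), ih fun i hi => ?_⟩
    rw [← iteratedDerivWithin_succ']
    exact h (i + 1) (by omega)

lemma of_succ {p : ℕ} {f : ℝ → F} (h : VanishesToOrder b (p + 1) f) : VanishesToOrder b p f := by
  induction p generalizing f with
  | zero => trivial
  | succ p ih => exact ⟨h.1, ih h.2⟩

lemma mono {p q : ℕ} (hpq : p ≤ q) {f : ℝ → F} (h : VanishesToOrder b q f) :
    VanishesToOrder b p f := by
  induction hpq with
  | refl => exact h
  | step _ ih => exact ih h.of_succ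

lemma congr (hb : b ∈ Icc (0 : ℝ) 1) {p : ℕ} {f g : ℝ → F} (h : VanishesToOrder b p f)
    (hfg : ∀ s ∈ Icc (0 : ℝ) 1, g s = f s) : VanishesToOrder b p g := by
  induction p generalizing f g with
  | zero => trivial
  | succ p ih =>
    exact ⟨(hfg b hb).trans h.1, ih h.2 fun s hs => derivWithin_congr hfg (hfg s hs)⟩

lemma zero (p : ℕ) : VanishesToOrder b p (fun _ => (0 : F)) := by
  induction p with
  | zero => trivial
  | succ p ih =>
    refine ⟨rfl, ?_⟩
    convert ih using 2
    simp

lemma add (hb : b ∈ Icc (0 : ℝ) 1) {p : ℕ} {f g : ℝ → F}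
    (hf : VanishesToOrder b p f) (hg : VanishesToOrder b p g)
    (hfs : ContDiffOn ℝ p f (Icc 0 1)) (hgs : ContDiffOn ℝ p g (Icc 0 1)) :
    VanishesToOrder b p (fun s => f s + g s) := by
  induction p generalizing f g with
  | zero => trivial
  | succ p ih =>
    refine ⟨by simp [hf.1, hg.1], ?_⟩
    refine (ih hf.2 hg.2 hfs.derivWithin_unitInterval hgs.derivWithin_unitInterval).congr hb
      fun s hs => derivWithin_unitInterval hs ?_
    exact (hfs.hasDerivWithinAt_unitInterval hs).add (hgs.hasDerivWithinAt_unitInterval hs)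

lemma bilinear (B : F →L[ℝ] G →L[ℝ] K) (hb : b ∈ Icc (0 : ℝ) 1) {p : ℕ} {f : ℝ → F} {g : ℝ → G}
    (hf : VanishesToOrder b p f)
    (hfs : ContDiffOn ℝ p f (Icc 0 1)) (hgs : ContDiffOn ℝ p g (Icc 0 1)) :
    VanishesToOrder b p (fun s => B (f s) (g s)) := by
  induction p generalizing f g with
  | zero => trivial
  | succ p ih =>
    refine ⟨by simp [hf.1], ?_⟩
    have hfs' : ContDiffOn ℝ p f (Icc 0 1) := hfs.of_le (by exact_mod_cast p.le_succ)
    have hgs' : ContDiffOn ℝ p g (Icc 0 1) := hgs.of_le (by exact_mod_cast p.le_succ)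
    have hB : ∀ {f : ℝ → F} {g : ℝ → G}, ContDiffOn ℝ p f (Icc 0 1) →
        ContDiffOn ℝ p g (Icc 0 1) → ContDiffOn ℝ p (fun s => B (f s) (g s)) (Icc 0 1) :=
      fun h₁ h₂ => (B.contDiff.comp_contDiffOn h₁).clm_apply h₂
    refine ((ih hf.of_succ hfs' hgs.derivWithin_unitInterval).add hb
      (ih hf.2 hfs.derivWithin_unitInterval hgs')
      (hB hfs' hgs.derivWithin_unitInterval) (hB hfs.derivWithin_unitInterval hgs')).congr hb
      fun s hs => derivWithin_unitInterval hs ?_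
    exact B.hasDerivWithinAt_of_bilinear (hfs.hasDerivWithinAt_unitInterval hs)
      (hgs.hasDerivWithinAt_unitInterval hs)

end VanishesToOrder

end Calculus

/-! ### Operator-valued functions of a real parameter -/

section Operators

variable {E : Type*} [NormedAddCommGroup E] [InnerProductSpace ℂ E]

/-- Evaluation of a complex-linear operator, as a real bilinear map. -/
noncomputable def evalBilin : (E →L[ℂ] E) →L[ℝ] E →L[ℝ] E :=
  ContinuousLinearMap.restrictScalarsL ℂ E E ℝ ℝ

@[simp] lemma evalBilin_apply (A : E →L[ℂ] E) (x : E) : evalBilin A x = A x := rfl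

lemma ContDiffOn.op_apply {n : WithTop ℕ∞} {A : ℝ → E →L[ℂ] E} {x : ℝ → E} {S : Set ℝ}
    (hA : ContDiffOn ℝ n A S) (hx : ContDiffOn ℝ n x S) :
    ContDiffOn ℝ n (fun s => A s (x s)) S := by
  have h : ContDiff ℝ n (evalBilin (E := E)) := (evalBilin (E := E)).contDiff
  exact (h.comp_contDiffOn hA).clm_apply hx

lemma HasDerivWithinAt.op_apply {A : ℝ → E →L[ℂ] E} {A' : E →L[ℂ] E} {x : ℝ → E} {x' : E}
    {S : Set ℝ} {s : ℝ} (hA : HasDerivWithinAt A A' S s) (hx : HasDerivWithinAt x x' S s) :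
    HasDerivWithinAt (fun s => A s (x s)) (A' (x s) + A s x') S s := by
  rw [add_comm]
  exact evalBilin.hasDerivWithinAt_of_bilinear hA hx

lemma isBoundedBilinearMap_rankOne :
    IsBoundedBilinearMap ℝ (fun p : E × E => InnerProductSpace.rankOne ℂ p.1 p.2) where
  add_left x₁ x₂ y := by simp
  smul_left c x y := by
    ext z
    exact smul_comm _ _ _
  add_right x y₁ y₂ := by simp
  smul_right c x y := by
    ext z
    simp [InnerProductSpace.rankOne_apply, inner_smul_left_eq_smul, mul_smul]
  bound := ⟨1, one_pos, fun x y => by simp⟩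

lemma ContDiffOn.rankOne {n : WithTop ℕ∞} {x y : ℝ → E} {S : Set ℝ}
    (hx : ContDiffOn ℝ n x S) (hy : ContDiffOn ℝ n y S) :
    ContDiffOn ℝ n (fun s => InnerProductSpace.rankOne ℂ (x s) (y s)) S := by
  have h := (isBoundedBilinearMap_rankOne (E := E)).contDiff (n := n)
  exact h.comp_contDiffOn (hx.prodMk hy)

lemma ContDiffOn.op_inverse [CompleteSpace E] {n : WithTop ℕ∞} {A : ℝ → E →L[ℂ] E} {S : Set ℝ}
    (hA : ContDiffOn ℝ n A S) (h : ∀ s ∈ S, IsUnit (A s)) :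
    ContDiffOn ℝ n (fun s => Ring.inverse (A s)) S := fun s hs => by
  obtain ⟨u, hu⟩ := h s hs
  have := contDiffAt_ringInverse ℝ (n := n) u
  rw [hu] at this
  exact this.comp_contDiffWithinAt s (hA s hs)

end Operators

/-! ### The reduced resolvent at a simple eigenvalue -/

section ReducedResolvent

variable {E : Type*} [NormedAddCommGroup E] [InnerProductSpace ℂ E]

/-- `μ` is a simple eigenvalue of the self-adjoint operator `T`, with unit eigenvector `v`. -/
structure IsSimpleEigenpair (T : E →L[ℂ] E) (μ : ℝ) (v : E) : Prop where
  symm : (T : E →ₗ[ℂ] E).IsSymmetric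
  norm_eq : ‖v‖ = 1
  eigen : T v = (μ : ℂ) • v
  simple : ∀ x, T x = (μ : ℂ) • x → x = inner ℂ v x • v

/-- `T - μ + |v⟩⟨v|`, which is invertible when `(μ, v)` is a simple eigenpair of `T`. -/
noncomputable def regularizedShift (T : E →L[ℂ] E) (μ : ℝ) (v : E) : E →L[ℂ] E :=
  T - (μ : ℂ) • 1 + InnerProductSpace.rankOne ℂ v v

/-- The reduced resolvent of `T` at a simple eigenpair `(μ, v)`: it inverts `T - μ` on the
orthogonal complement of `v` and annihilates `v`. -/
noncomputable def reducedResolvent (T : E →L[ℂ] E) (μ : ℝ) (v : E) : E →L[ℂ] E :=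
  Ring.inverse (regularizedShift T μ v) - InnerProductSpace.rankOne ℂ v v

lemma regularizedShift_apply (T : E →L[ℂ] E) (μ : ℝ) (v x : E) :
    regularizedShift T μ v x = T x - (μ : ℂ) • x + inner ℂ v x • v := by
  simp [regularizedShift]

namespace IsSimpleEigenpair

variable {T : E →L[ℂ] E} {μ : ℝ} {v : E}

lemma inner_self_eq (h : IsSimpleEigenpair T μ v) : inner ℂ v v = (1 : ℂ) := by
  simp [inner_self_eq_norm_sq_to_K, h.norm_eq]

lemma inner_map_sub (h : IsSimpleEigenpair T μ v) (x : E) :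
    inner ℂ v (T x - (μ : ℂ) • x) = 0 := by
  have h1 : inner ℂ v (T x) = inner ℂ (T v) x := (h.symm v x).symm
  rw [inner_sub_right, inner_smul_right, h1, h.eigen, inner_smul_left, Complex.conj_ofReal,
    sub_self]

lemma inner_regularizedShift (h : IsSimpleEigenpair T μ v) (x : E) :
    inner ℂ v (regularizedShift T μ v x) = inner ℂ v x := by
  rw [regularizedShift_apply, inner_add_right, h.inner_map_sub, inner_smul_right, h.inner_self_eq]
  ring

lemma regularizedShift_self (h : IsSimpleEigenpair T μ v) : regularizedShift T μ v v = v := by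
  rw [regularizedShift_apply, h.eigen, h.inner_self_eq]
  simp

variable [FiniteDimensional ℂ E]

lemma isUnit_regularizedShift (h : IsSimpleEigenpair T μ v) :
    IsUnit (regularizedShift T μ v) := by
  have : CompleteSpace E := FiniteDimensional.complete ℂ E
  rw [ContinuousLinearMap.isUnit_iff_bijective]
  have hinj : Function.Injective (regularizedShift T μ v : E →ₗ[ℂ] E) := by
    rw [injective_iff_map_eq_zero]
    intro x hx
    have hx : regularizedShift T μ v x = 0 := hx
    have h0 : inner ℂ v x = 0 := by rw [← h.inner_regularizedShift, hx, inner_zero_right]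
    rw [regularizedShift_apply, h0, zero_smul, add_zero, sub_eq_zero] at hx
    rw [h.simple x hx, h0, zero_smul]
  exact ⟨hinj, LinearMap.surjective_of_injective hinj⟩

lemma inverse_regularizedShift (h : IsSimpleEigenpair T μ v) (x : E) :
    Ring.inverse (regularizedShift T μ v) (regularizedShift T μ v x) = x := by
  have := Ring.inverse_mul_cancel _ h.isUnit_regularizedShift
  exact congrArg (fun A : E →L[ℂ] E => A x) this

lemma regularizedShift_inverse (h : IsSimpleEigenpair T μ v) (x : E) :
    regularizedShift T μ v (Ring.inverse (regularizedShift T μ v) x) = x := by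
  have := Ring.mul_inverse_cancel _ h.isUnit_regularizedShift
  exact congrArg (fun A : E →L[ℂ] E => A x) this

lemma inner_inverse_regularizedShift (h : IsSimpleEigenpair T μ v) (x : E) :
    inner ℂ v (Ring.inverse (regularizedShift T μ v) x) = inner ℂ v x := by
  rw [← h.inner_regularizedShift, h.regularizedShift_inverse]

lemma reducedResolvent_self (h : IsSimpleEigenpair T μ v) : reducedResolvent T μ v v = 0 := by
  have := h.inverse_regularizedShift v
  rw [h.regularizedShift_self] at this
  simp [reducedResolvent, this, h.norm_eq]

lemma inner_reducedResolvent (h : IsSimpleEigenpair T μ v) (x : E) :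
    inner ℂ v (reducedResolvent T μ v x) = 0 := by
  simp [reducedResolvent, h.inner_inverse_regularizedShift, h.norm_eq]

lemma map_reducedResolvent (h : IsSimpleEigenpair T μ v) (x : E) :
    T (reducedResolvent T μ v x) - (μ : ℂ) • reducedResolvent T μ v x = x - inner ℂ v x • v := by
  have h1 := regularizedShift_apply T μ v (reducedResolvent T μ v x)
  rw [h.inner_reducedResolvent, zero_smul, add_zero] at h1
  rw [← h1, reducedResolvent, sub_apply, map_sub, h.regularizedShift_inverse,
    InnerProductSpace.rankOne_apply, map_smul, h.regularizedShift_self]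

lemma reducedResolvent_map (h : IsSimpleEigenpair T μ v) (x : E) :
    reducedResolvent T μ v (T x - (μ : ℂ) • x) = x - inner ℂ v x • v := by
  have h1 : T x - (μ : ℂ) • x = regularizedShift T μ v x - inner ℂ v x • v := by
    rw [regularizedShift_apply]; abel
  rw [reducedResolvent, sub_apply, InnerProductSpace.rankOne_apply,
    h.inner_map_sub, zero_smul, sub_zero, h1, map_sub, h.inverse_regularizedShift, map_smul]
  congr 2
  have := h.inverse_regularizedShift v
  rwa [h.regularizedShift_self] at this

lemma inner_reducedResolvent_comm (h : IsSimpleEigenpair T μ v) (x y : E) :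
    inner ℂ (reducedResolvent T μ v x) y = inner ℂ x (reducedResolvent T μ v y) := by
  set R := reducedResolvent T μ v
  have hx : x = (T (R x) - (μ : ℂ) • R x) + inner ℂ v x • v := by
    rw [h.map_reducedResolvent]; abel
  have hy : y = (T (R y) - (μ : ℂ) • R y) + inner ℂ v y • v := by
    rw [h.map_reducedResolvent]; abel
  have h1 : inner ℂ (R x) v = 0 := inner_eq_zero_symm.1 (h.inner_reducedResolvent x)
  have h2 : inner ℂ v (R y) = 0 := h.inner_reducedResolvent y
  have h3 : inner ℂ (T (R x)) (R y) = inner ℂ (R x) (T (R y)) := h.symm _ _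
  conv_lhs => rw [hy]
  conv_rhs => rw [hx]
  simp [h1, h2, h3]

/-- Matrix elements of the powers of the reduced resolvent in another eigenvector. -/
lemma inner_reducedResolvent_pow (h : IsSimpleEigenpair T μ v) {w : E} {ν : ℝ}
    (hw : T w = (ν : ℂ) • w) (hν : ν ≠ μ) (hvw : inner ℂ w v = 0) (k : ℕ) (x : E) :
    inner ℂ w ((reducedResolvent T μ v ^ k) x) = inner ℂ w x / (((ν - μ) ^ k : ℝ) : ℂ) := by
  have h0 : ((ν - μ : ℝ) : ℂ) ≠ 0 := by exact_mod_cast sub_ne_zero.2 hν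
  have h1 : ∀ x, inner ℂ w (reducedResolvent T μ v x) = inner ℂ w x / ((ν - μ : ℝ) : ℂ) := by
    intro x
    rw [eq_div_iff h0]
    have h2 := congrArg (inner ℂ w) (h.map_reducedResolvent x)
    have h3 : inner ℂ w (T (reducedResolvent T μ v x)) =
      inner ℂ (T w) (reducedResolvent T μ v x) := (h.symm _ _).symm
    rw [inner_sub_right, inner_sub_right, inner_smul_right, inner_smul_right, hvw, h3, hw,
      inner_smul_left, Complex.conj_ofReal] at h2
    push_cast
    linear_combination h2
  induction k with
  | zero => simp
  | succ k ih =>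
    rw [pow_succ', mul_apply_eq_comp, h1, ih]
    push_cast at h0 ⊢
    rw [pow_succ, div_div]

end IsSimpleEigenpair

end ReducedResolvent

/-! ### Regularity of a parallel eigenvector -/

section ParallelEigenvector

variable {E : Type*} [NormedAddCommGroup E] [InnerProductSpace ℂ E]

/-- `e s` is, for `s ∈ [0, 1]`, a differentiable unit eigenvector of `H s` for the simple eigenvalue
`lam s`, with the parallel choice of phase `⟨e, e'⟩ = 0`. -/
structure IsParallelEigenvector (H : ℝ → E →L[ℂ] E) (lam : ℝ → ℝ) (e : ℝ → E) : Prop where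
  eigenpair : ∀ s ∈ Icc (0 : ℝ) 1, IsSimpleEigenpair (H s) (lam s) (e s)
  differentiable : DifferentiableOn ℝ e (Icc 0 1)
  parallel : ∀ s ∈ Icc (0 : ℝ) 1, inner ℂ (e s) (derivWithin e (Icc 0 1) s) = 0

/-- An eigenvalue is as regular as its operator and a normalized eigenvector. -/
lemma contDiffOn_eigenvalue {n : WithTop ℕ∞} {H : ℝ → E →L[ℂ] E} {lam : ℝ → ℝ} {e : ℝ → E}
    (hH : ContDiffOn ℝ n H (Icc 0 1)) (he : ContDiffOn ℝ n e (Icc 0 1))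
    (hnorm : ∀ s ∈ Icc (0 : ℝ) 1, ‖e s‖ = 1)
    (heig : ∀ s ∈ Icc (0 : ℝ) 1, H s (e s) = (lam s : ℂ) • e s) :
    ContDiffOn ℝ n lam (Icc 0 1) := by
  have h1 : ContDiffOn ℝ n (fun s => (inner ℂ (e s) (H s (e s))).re) (Icc 0 1) :=
    Complex.reCLM.contDiff.comp_contDiffOn (he.inner ℂ (hH.op_apply he))
  refine h1.congr fun s hs => ?_
  rw [heig s hs, inner_smul_right, inner_self_eq_norm_sq_to_K, hnorm s hs]
  simp

lemma differentiableOn_eigenvalue {H : ℝ → E →L[ℂ] E} {lam : ℝ → ℝ} {e : ℝ → E}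
    (hH : DifferentiableOn ℝ H (Icc 0 1)) (he : DifferentiableOn ℝ e (Icc 0 1))
    (hnorm : ∀ s ∈ Icc (0 : ℝ) 1, ‖e s‖ = 1)
    (heig : ∀ s ∈ Icc (0 : ℝ) 1, H s (e s) = (lam s : ℂ) • e s) :
    DifferentiableOn ℝ lam (Icc 0 1) := by
  have h1 : DifferentiableOn ℝ (fun s => (inner ℂ (e s) (H s (e s))).re) (Icc 0 1) :=
    fun s hs => Complex.reCLM.differentiableAt.comp_differentiableWithinAt s
      (DifferentiableWithinAt.inner ℂ (he s hs) ((hH s hs).hasDerivWithinAt.op_apply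
        (he s hs).hasDerivWithinAt).differentiableWithinAt)
  refine h1.congr fun s hs => ?_
  rw [heig s hs, inner_smul_right, inner_self_eq_norm_sq_to_K, hnorm s hs]
  simp

lemma IsParallelEigenvector.contDiffOn_lam {H : ℝ → E →L[ℂ] E} {lam : ℝ → ℝ} {e : ℝ → E}
    (h : IsParallelEigenvector H lam e) {n : WithTop ℕ∞}
    (hH : ContDiffOn ℝ n H (Icc 0 1)) (he : ContDiffOn ℝ n e (Icc 0 1)) :
    ContDiffOn ℝ n lam (Icc 0 1) :=
  contDiffOn_eigenvalue hH he (fun s hs => (h.eigenpair s hs).norm_eq)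
    fun s hs => (h.eigenpair s hs).eigen

/-- The derivative of the eigenvalue equation. -/
lemma map_derivWithin_eigenvector {H : ℝ → E →L[ℂ] E} {lam : ℝ → ℝ} {e : ℝ → E}
    (hH : DifferentiableOn ℝ H (Icc 0 1)) (hlam : DifferentiableOn ℝ lam (Icc 0 1))
    (he : DifferentiableOn ℝ e (Icc 0 1))
    (heig : ∀ s ∈ Icc (0 : ℝ) 1, H s (e s) = (lam s : ℂ) • e s) {s : ℝ} (hs : s ∈ Icc (0 : ℝ) 1) :
    H s (derivWithin e (Icc 0 1) s) - (lam s : ℂ) • derivWithin e (Icc 0 1) s =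
      ((derivWithin lam (Icc 0 1) s : ℝ) : ℂ) • e s - derivWithin H (Icc 0 1) s (e s) := by
  have he' := (he s hs).hasDerivWithinAt
  have h1 := ((hH s hs).hasDerivWithinAt).op_apply he'
  have h2 : HasDerivWithinAt (fun s => (lam s : ℂ) • e s) _ (Icc 0 1) s :=
    ((hlam s hs).hasDerivWithinAt.ofReal_comp).smul he'
  have h3 := derivWithin_unitInterval hs h1
  rw [derivWithin_congr heig (heig s hs), derivWithin_unitInterval hs h2] at h3
  rw [sub_eq_sub_iff_add_eq_add, add_comm _ (derivWithin H (Icc 0 1) s (e s)), ← h3, add_comm]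

variable [FiniteDimensional ℂ E]

lemma contDiffOn_reducedResolvent {n : WithTop ℕ∞} {H : ℝ → E →L[ℂ] E} {lam : ℝ → ℝ} {e : ℝ → E}
    (hH : ContDiffOn ℝ n H (Icc 0 1)) (hlam : ContDiffOn ℝ n lam (Icc 0 1))
    (hP : ContDiffOn ℝ n (fun s => InnerProductSpace.rankOne ℂ (e s) (e s)) (Icc 0 1))
    (h : ∀ s ∈ Icc (0 : ℝ) 1, IsSimpleEigenpair (H s) (lam s) (e s)) :
    ContDiffOn ℝ n (fun s => reducedResolvent (H s) (lam s) (e s)) (Icc 0 1) := by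
  have : CompleteSpace E := FiniteDimensional.complete ℂ E
  have h1 : ContDiffOn ℝ n (fun s => (lam s : ℂ)) (Icc 0 1) :=
    Complex.ofRealCLM.contDiff.comp_contDiffOn hlam
  refine ContDiffOn.sub (ContDiffOn.op_inverse ?_ fun s hs => (h s hs).isUnit_regularizedShift) hP
  exact (hH.sub (h1.smul contDiffOn_const)).add hP

namespace IsParallelEigenvector

variable {H : ℝ → E →L[ℂ] E} {lam : ℝ → ℝ} {e : ℝ → E}

lemma contDiffOn_resolvent (h : IsParallelEigenvector H lam e) {n : WithTop ℕ∞}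
    (hH : ContDiffOn ℝ n H (Icc 0 1)) (he : ContDiffOn ℝ n e (Icc 0 1)) :
    ContDiffOn ℝ n (fun s => reducedResolvent (H s) (lam s) (e s)) (Icc 0 1) :=
  contDiffOn_reducedResolvent hH (h.contDiffOn_lam hH he) (he.rankOne he) h.eigenpair

/-- First order perturbation theory in differential form: `e' = -R H' e`. -/
lemma derivWithin_eq (h : IsParallelEigenvector H lam e)
    (hH : DifferentiableOn ℝ H (Icc 0 1)) {s : ℝ} (hs : s ∈ Icc (0 : ℝ) 1) :
    derivWithin e (Icc 0 1) s =
      -reducedResolvent (H s) (lam s) (e s) (derivWithin H (Icc 0 1) s (e s)) := by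
  have hp := h.eigenpair s hs
  have hlam : DifferentiableOn ℝ lam (Icc 0 1) :=
    differentiableOn_eigenvalue hH h.differentiable (fun s hs => (h.eigenpair s hs).norm_eq)
      fun s hs => (h.eigenpair s hs).eigen
  have h1 := congrArg (reducedResolvent (H s) (lam s) (e s)) (map_derivWithin_eigenvector hH hlam
    h.differentiable (fun s hs => (h.eigenpair s hs).eigen) hs)
  rwa [hp.reducedResolvent_map, h.parallel s hs, zero_smul, sub_zero, map_sub, map_smul,
    hp.reducedResolvent_self, smul_zero, zero_sub] at h1

/-- Bootstrapping `e' = -R H' e`, in which `R` is as regular as `H` and `e`, shows that `e` is as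
regular as `H`. -/
lemma contDiffOn (h : IsParallelEigenvector H lam e) {r : ℕ}
    (hH : ContDiffOn ℝ r H (Icc 0 1)) : ContDiffOn ℝ r e (Icc 0 1) := by
  induction r with
  | zero => exact_mod_cast contDiffOn_zero.2 h.differentiable.continuousOn
  | succ r ih =>
    have hH' : ContDiffOn ℝ r H (Icc 0 1) := hH.of_le (by exact_mod_cast r.le_succ)
    have he := ih hH'
    refine contDiffOn_succ_of_hasDerivWithinAt
      (fun s hs => (h.differentiable s hs).hasDerivWithinAt) ?_
    refine (((h.contDiffOn_resolvent hH' he).op_apply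
      (hH.derivWithin_unitInterval.op_apply he)).neg).congr fun s hs => ?_
    exact h.derivWithin_eq (hH.differentiableOn (by simp)) hs

end IsParallelEigenvector

end ParallelEigenvector

/-! ### The adiabatic expansion -/

section VanishingProducts

variable {E : Type*} [NormedAddCommGroup E] [InnerProductSpace ℂ E] {b : ℝ}

namespace VanishesToOrder

lemma op_apply_left (hb : b ∈ Icc (0 : ℝ) 1) {p : ℕ} {A : ℝ → E →L[ℂ] E} {x : ℝ → E}
    (h : VanishesToOrder b p A) (hA : ContDiffOn ℝ p A (Icc 0 1))
    (hx : ContDiffOn ℝ p x (Icc 0 1)) : VanishesToOrder b p (fun s => A s (x s)) :=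
  h.bilinear evalBilin hb hA hx

lemma op_apply_right (hb : b ∈ Icc (0 : ℝ) 1) {p : ℕ} {A : ℝ → E →L[ℂ] E} {x : ℝ → E}
    (h : VanishesToOrder b p x) (hA : ContDiffOn ℝ p A (Icc 0 1))
    (hx : ContDiffOn ℝ p x (Icc 0 1)) : VanishesToOrder b p (fun s => A s (x s)) :=
  h.bilinear (evalBilin (E := E)).flip hb hx hA

lemma smul (hb : b ∈ Icc (0 : ℝ) 1) {p : ℕ} {c : ℝ → ℂ} {x : ℝ → E}
    (h : VanishesToOrder b p x) (hc : ContDiffOn ℝ p c (Icc 0 1))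
    (hx : ContDiffOn ℝ p x (Icc 0 1)) : VanishesToOrder b p (fun s => c s • x s) :=
  h.bilinear (ContinuousLinearMap.lsmul ℝ ℂ : ℂ →L[ℝ] E →L[ℝ] E).flip hb hx hc

end VanishesToOrder

end VanishingProducts

section Expansion

variable {E : Type*} [NormedAddCommGroup E] [InnerProductSpace ℂ E]

lemma contDiffOn_iteratedDerivWithin {F : Type*} [NormedAddCommGroup F] [NormedSpace ℝ F]
    {H : ℝ → F} {r : ℕ} (hH : ContDiffOn ℝ r H (Icc 0 1)) {n k : ℕ} (h : n + k = r) :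
    ContDiffOn ℝ n (iteratedDerivWithin k H (Icc 0 1)) (Icc 0 1) := by
  induction k generalizing n with
  | zero => subst h; simpa using hH
  | succ k ih =>
    rw [show iteratedDerivWithin (k + 1) H (Icc 0 1) =
      derivWithin (iteratedDerivWithin k H (Icc 0 1)) (Icc 0 1) from
      iteratedDerivWithin_succ]
    exact (ih (n := n + 1) (by omega)).derivWithin_unitInterval

lemma vanishesToOrder_iteratedDerivWithin {F : Type*} [NormedAddCommGroup F] [NormedSpace ℝ F]
    {H : ℝ → F} {b : ℝ} {p k : ℕ} (hk : k ≤ p)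
    (h : VanishesToOrder b p (derivWithin H (Icc 0 1))) :
    VanishesToOrder b (p - k) (iteratedDerivWithin (k + 1) H (Icc 0 1)) := by
  induction k with
  | zero =>
    rw [show iteratedDerivWithin (0 + 1) H (Icc 0 1) = derivWithin H (Icc 0 1) from
      funext fun _ => by rw [zero_add, iteratedDerivWithin_one]]
    exact h
  | succ k ih =>
    rw [show iteratedDerivWithin (k + 1 + 1) H (Icc 0 1) =
      derivWithin (iteratedDerivWithin (k + 1) H (Icc 0 1)) (Icc 0 1) from
      iteratedDerivWithin_succ]
    have := ih (by omega)
    rw [show p - k = p - (k + 1) + 1 by omega] at this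
    exact this.2

/-- The part orthogonal to `e` of the coefficient that follows `u` in the adiabatic expansion. -/
noncomputable def orthogonalCorrection (H : ℝ → E →L[ℂ] E) (lam : ℝ → ℝ) (e u : ℝ → E)
    (s : ℝ) : E :=
  Complex.I • reducedResolvent (H s) (lam s) (e s) (derivWithin u (Icc 0 1) s)

/-- The amplitude along `e` for which `w + (longitudinalCorrection e w) • e` has a derivative
orthogonal to `e`, normalized to vanish at `s = 0`. -/
noncomputable def longitudinalCorrection (e w : ℝ → E) : ℝ → ℂ :=
  primitiveOn fun t => inner ℂ (derivWithin e (Icc 0 1) t) (w t)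

/-- The coefficients `u k` of the adiabatic expansion `∑ τ⁻ᵏ u k` of the solution that follows the
eigenvector `e`, up to the dynamical phase. They solve `(H - lam) u (k + 1) = i (u k)'`. -/
noncomputable def adiabaticCoeff (H : ℝ → E →L[ℂ] E) (lam : ℝ → ℝ) (e : ℝ → E) : ℕ → ℝ → E
  | 0 => e
  | k + 1 => fun s =>
    orthogonalCorrection H lam e (adiabaticCoeff H lam e k) s +
      longitudinalCorrection e (orthogonalCorrection H lam e (adiabaticCoeff H lam e k)) s • e s

lemma adiabaticCoeff_succ (H : ℝ → E →L[ℂ] E) (lam : ℝ → ℝ) (e : ℝ → E) (k : ℕ) (s : ℝ) :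
    adiabaticCoeff H lam e (k + 1) s =
      orthogonalCorrection H lam e (adiabaticCoeff H lam e k) s +
      longitudinalCorrection e (orthogonalCorrection H lam e (adiabaticCoeff H lam e k)) s • e s :=
  rfl

namespace IsParallelEigenvector

variable [FiniteDimensional ℂ E] {H : ℝ → E →L[ℂ] E} {lam : ℝ → ℝ} {e : ℝ → E} {r : ℕ}

lemma contDiffOn_orthogonalCorrection (h : IsParallelEigenvector H lam e)
    (hH : ContDiffOn ℝ r H (Icc 0 1)) {n : ℕ} (hn : n ≤ r) {u : ℝ → E}
    (hu : ContDiffOn ℝ (n + 1 : ℕ) u (Icc 0 1)) :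
    ContDiffOn ℝ n (orthogonalCorrection H lam e u) (Icc 0 1) :=
  contDiffOn_const.smul ((((h.contDiffOn_resolvent hH (h.contDiffOn hH))).of_le
    (by exact_mod_cast hn)).op_apply hu.derivWithin_unitInterval)

lemma hasDerivWithinAt_longitudinalCorrection (h : IsParallelEigenvector H lam e)
    (hH : ContDiffOn ℝ (r + 1 : ℕ) H (Icc 0 1)) {w : ℝ → E}
    (hw : ContinuousOn w (Icc 0 1)) {s : ℝ} (hs : s ∈ Icc (0 : ℝ) 1) :
    HasDerivWithinAt (longitudinalCorrection e w)
      (inner ℂ (derivWithin e (Icc 0 1) s) (w s)) (Icc 0 1) s :=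
  hasDerivWithinAt_primitiveOn
    ((h.contDiffOn hH).derivWithin_unitInterval.continuousOn.inner hw) hs

lemma contDiffOn_longitudinalCorrection (h : IsParallelEigenvector H lam e)
    (hH : ContDiffOn ℝ (r + 1 : ℕ) H (Icc 0 1)) {n : ℕ} (hn : n ≤ r) {w : ℝ → E}
    (hw : ContDiffOn ℝ n w (Icc 0 1)) :
    ContDiffOn ℝ (n + 1 : ℕ) (longitudinalCorrection e w) (Icc 0 1) :=
  contDiffOn_succ_of_hasDerivWithinAt
    (fun _ hs => h.hasDerivWithinAt_longitudinalCorrection hH hw.continuousOn hs)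
    (((h.contDiffOn hH).derivWithin_unitInterval.of_le (by exact_mod_cast hn)).inner ℂ hw)

/-- Each coefficient of the adiabatic expansion loses one derivative. -/
lemma contDiffOn_adiabaticCoeff (h : IsParallelEigenvector H lam e)
    (hH : ContDiffOn ℝ r H (Icc 0 1)) {n k : ℕ} (hnk : n + k = r) :
    ContDiffOn ℝ n (adiabaticCoeff H lam e k) (Icc 0 1) := by
  induction k generalizing n with
  | zero => subst hnk; exact h.contDiffOn hH
  | succ k ih =>
    obtain ⟨r, rfl⟩ : ∃ r', r = r' + 1 := ⟨n + k, by omega⟩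
    have hw := h.contDiffOn_orthogonalCorrection hH (n := n) (by omega) (ih (by omega))
    refine hw.add (ContDiffOn.smul ?_ ((h.contDiffOn hH).of_le (by exact_mod_cast (by omega))))
    exact (h.contDiffOn_longitudinalCorrection hH (by omega) hw).of_le
      (by exact_mod_cast n.le_succ)

lemma inner_orthogonalCorrection (h : IsParallelEigenvector H lam e) (u : ℝ → E) {s : ℝ}
    (hs : s ∈ Icc (0 : ℝ) 1) : inner ℂ (e s) (orthogonalCorrection H lam e u s) = 0 := by
  rw [orthogonalCorrection, inner_smul_right, (h.eigenpair s hs).inner_reducedResolvent, mul_zero]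

/-- The solvability condition for the next coefficient. -/
lemma inner_derivWithin_adiabaticCoeff (h : IsParallelEigenvector H lam e)
    (hH : ContDiffOn ℝ r H (Icc 0 1)) {k : ℕ} (hk : k < r) {s : ℝ} (hs : s ∈ Icc (0 : ℝ) 1) :
    inner ℂ (e s) (derivWithin (adiabaticCoeff H lam e k) (Icc 0 1) s) = 0 := by
  cases k with
  | zero => exact h.parallel s hs
  | succ k =>
    obtain ⟨r, rfl⟩ : ∃ r', r = r' + 1 := ⟨r - 1, by omega⟩
    set w := orthogonalCorrection H lam e (adiabaticCoeff H lam e k) with hw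
    have hws : ContDiffOn ℝ (0 + 1 : ℕ) w (Icc 0 1) :=
      h.contDiffOn_orthogonalCorrection hH (by omega)
        ((h.contDiffOn_adiabaticCoeff hH (n := r + 1 - k) (k := k) (by omega)).of_le
          (by exact_mod_cast (by omega)))
    have hw' := hws.hasDerivWithinAt_unitInterval hs
    have he' := (h.differentiable s hs).hasDerivWithinAt
    have hc' := h.hasDerivWithinAt_longitudinalCorrection hH hws.continuousOn hs
    have hu : HasDerivWithinAt (adiabaticCoeff H lam e (k + 1)) _ (Icc 0 1) s :=
      hw'.add (hc'.smul he')
    -- differentiating `⟨e, w⟩ = 0` moves the derivative from `w` to `e`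
    have h0 : inner ℂ (e s) (derivWithin w (Icc 0 1) s) +
        inner ℂ (derivWithin e (Icc 0 1) s) (w s) = 0 := by
      rw [← derivWithin_unitInterval hs (he'.inner ℂ hw'),
        derivWithin_congr (f := fun _ => (0 : ℂ))
          (fun t ht => h.inner_orthogonalCorrection _ ht) (h.inner_orthogonalCorrection _ hs)]
      simp
    rw [derivWithin_unitInterval hs hu, inner_add_right, inner_add_right, inner_smul_right,
      inner_smul_right, h.parallel s hs, (h.eigenpair s hs).inner_self_eq]
    linear_combination h0

lemma map_adiabaticCoeff_succ (h : IsParallelEigenvector H lam e)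
    (hH : ContDiffOn ℝ r H (Icc 0 1)) {k : ℕ} (hk : k < r) {s : ℝ} (hs : s ∈ Icc (0 : ℝ) 1) :
    H s (adiabaticCoeff H lam e (k + 1) s) - (lam s : ℂ) • adiabaticCoeff H lam e (k + 1) s =
      Complex.I • derivWithin (adiabaticCoeff H lam e k) (Icc 0 1) s := by
  have h1 := (h.eigenpair s hs).map_reducedResolvent
    (derivWithin (adiabaticCoeff H lam e k) (Icc 0 1) s)
  rw [h.inner_derivWithin_adiabaticCoeff hH hk hs, zero_smul, sub_zero] at h1
  rw [adiabaticCoeff_succ, orthogonalCorrection, map_add, map_smul, map_smul,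
    (h.eigenpair s hs).eigen]
  conv_rhs => rw [← h1]
  module

/-- If `H'` vanishes to order `p` at `b`, then modulo terms along `e` and terms that vanish to
higher order, the coefficient of order `k + 1 ≤ p + 1` is `-iᵏ⁺¹ Rᵏ⁺² H⁽ᵏ⁺¹⁾ e`. -/
lemma exists_adiabaticCoeff_eq (h : IsParallelEigenvector H lam e)
    (hH : ContDiffOn ℝ r H (Icc 0 1)) {b : ℝ} (hb : b ∈ Icc (0 : ℝ) 1) {p : ℕ} (hr : p + 2 ≤ r)
    (hv : VanishesToOrder b p (derivWithin H (Icc 0 1))) {k : ℕ} (hk : k ≤ p) :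
    ∃ (g : ℝ → E) (c : ℝ → ℂ),
      (∀ n, n + (k + 1) = r → ContDiffOn ℝ n g (Icc 0 1) ∧ ContDiffOn ℝ n c (Icc 0 1)) ∧
      VanishesToOrder b (p + 1 - k) g ∧
      ∀ s ∈ Icc (0 : ℝ) 1, adiabaticCoeff H lam e (k + 1) s =
        -(Complex.I ^ (k + 1)) • (reducedResolvent (H s) (lam s) (e s) ^ (k + 2))
          (iteratedDerivWithin (k + 1) H (Icc 0 1) s (e s)) + g s + c s • e s := by
  have he := h.contDiffOn hH
  set R : ℝ → E →L[ℂ] E := fun s => reducedResolvent (H s) (lam s) (e s) with hR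
  have hRs : ContDiffOn ℝ r R (Icc 0 1) := h.contDiffOn_resolvent hH he
  obtain ⟨r, rfl⟩ : ∃ r', r = r' + 1 := ⟨r - 1, by omega⟩
  have le : ∀ {a c : ℕ}, a ≤ c → ((a : WithTop ℕ∞) ≤ (c : WithTop ℕ∞)) :=
    fun h => by exact_mod_cast h
  have hlong : ∀ k n, n + (k + 1) = r + 1 → ContDiffOn ℝ n (longitudinalCorrection e
      (orthogonalCorrection H lam e (adiabaticCoeff H lam e k))) (Icc 0 1) := fun k n hn =>
    (h.contDiffOn_longitudinalCorrection hH (by omega) (h.contDiffOn_orthogonalCorrection hH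
      (by omega) (h.contDiffOn_adiabaticCoeff hH (n := n + 1) (by omega)))).of_le (le n.le_succ)
  -- by `e' = -R H' e`, the derivative of `e` vanishes to the same order as that of `H`
  have hev : VanishesToOrder b p (derivWithin e (Icc 0 1)) := by
    have hH' := hH.derivWithin_unitInterval.of_le (le (show p ≤ r by omega))
    have he0 := he.of_le (le (show p ≤ r + 1 by omega))
    refine ((((hv.op_apply_left hb hH' he0).op_apply_right hb
      (hRs.of_le (le (show p ≤ r + 1 by omega))) (hH'.op_apply he0))).smul (c := fun _ => -1) hb
      contDiffOn_const ((hRs.of_le (le (by omega))).op_apply (hH'.op_apply he0))).congr hb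
      fun s hs => ?_
    rw [h.derivWithin_eq (hH.differentiableOn (by simp)) hs, neg_one_smul]
  induction k with
  | zero =>
    refine ⟨fun _ => 0, _, fun n hn => ⟨contDiffOn_const, hlong 0 n hn⟩, VanishesToOrder.zero _,
      fun s hs => ?_⟩
    have h1 : derivWithin (adiabaticCoeff H lam e 0) (Icc 0 1) s = _ :=
      h.derivWithin_eq (hH.differentiableOn (by simp)) hs
    rw [adiabaticCoeff_succ, orthogonalCorrection, h1]
    simp [pow_succ]
  | succ k ih =>
    obtain ⟨g, c, hgc, hg, hu⟩ := ih (by omega)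
    obtain ⟨n, hn⟩ : ∃ n, n + (k + 2) = r + 1 := ⟨r + 1 - (k + 2), by omega⟩
    obtain ⟨q, rfl⟩ : ∃ q, p = q + (k + 1) := ⟨p - (k + 1), by omega⟩
    rw [show q + (k + 1) + 1 - k = q + 1 + 1 by omega] at hg
    rw [show q + (k + 1) + 1 - (k + 1) = q + 1 by omega]
    have hqn : q + 1 ≤ n := by omega
    obtain ⟨hgs, hcs⟩ := hgc (n + 1) (by omega)
    set S : ℝ → E →L[ℂ] E := fun s => R s ^ (k + 2) with hS
    have hSs : ContDiffOn ℝ (r + 1 : ℕ) S (Icc 0 1) := hRs.pow _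
    set K := iteratedDerivWithin (k + 1) H (Icc 0 1) with hK
    have hKs : ContDiffOn ℝ (n + 1 : ℕ) K (Icc 0 1) :=
      contDiffOn_iteratedDerivWithin hH (by omega)
    have hKv : VanishesToOrder b (q + 1) K := by
      have := vanishesToOrder_iteratedDerivWithin (k := k) (by omega) hv
      rwa [show q + (k + 1) - k = q + 1 by omega] at this
    set lamk : ℂ := -(Complex.I ^ (k + 1)) with hlamk
    have he' : ContDiffOn ℝ n (derivWithin e (Icc 0 1)) (Icc 0 1) :=
      he.derivWithin_unitInterval.of_le (le (by omega))
    have heV : VanishesToOrder b (q + 1) (derivWithin e (Icc 0 1)) := hev.mono (by omega)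
    have hen : ContDiffOn ℝ n e (Icc 0 1) := he.of_le (le (by omega))
    have hSn : ContDiffOn ℝ n S (Icc 0 1) := hSs.of_le (le (by omega))
    have hRn : ContDiffOn ℝ n R (Icc 0 1) := hRs.of_le (le (by omega))
    have hKn : ContDiffOn ℝ n K (Icc 0 1) := hKs.of_le (le n.le_succ)
    have hcn : ContDiffOn ℝ n c (Icc 0 1) := hcs.of_le (le n.le_succ)
    have hS'n : ContDiffOn ℝ n (derivWithin S (Icc 0 1)) (Icc 0 1) :=
      hSs.derivWithin_unitInterval.of_le (le (by omega))
    have hg'n := hgs.derivWithin_unitInterval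
    -- the four contributions to the derivative that vanish to order `q + 1`
    set X₁ : ℝ → E := fun s => lamk • derivWithin S (Icc 0 1) s (K s (e s)) with hX₁
    set X₂ : ℝ → E := fun s => lamk • S s (K s (derivWithin e (Icc 0 1) s)) with hX₂
    set X₃ : ℝ → E := derivWithin g (Icc 0 1) with hX₃
    set X₄ : ℝ → E := fun s => c s • derivWithin e (Icc 0 1) s with hX₄
    have h₁ : ContDiffOn ℝ n X₁ (Icc 0 1) :=
      contDiffOn_const.smul (hS'n.op_apply (hKn.op_apply hen))
    have h₂ : ContDiffOn ℝ n X₂ (Icc 0 1) :=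
      contDiffOn_const.smul (hSn.op_apply (hKn.op_apply he'))
    have h₄ : ContDiffOn ℝ n X₄ (Icc 0 1) := hcn.smul he'
    have v₁ : VanishesToOrder b (q + 1) X₁ :=
      ((hKv.op_apply_left hb (hKs.of_le (le (by omega)))
        (he.of_le (le (by omega)))).op_apply_right hb (hS'n.of_le (le hqn))
        ((hKn.op_apply hen).of_le (le hqn))).smul hb contDiffOn_const
        ((hS'n.op_apply (hKn.op_apply hen)).of_le (le hqn))
    have v₂ : VanishesToOrder b (q + 1) X₂ :=
      ((hKv.op_apply_left hb (hKs.of_le (le (by omega)))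
        (he'.of_le (le (by omega)))).op_apply_right hb (hSn.of_le (le hqn))
        ((hKn.op_apply he').of_le (le hqn))).smul hb contDiffOn_const
        ((hSn.op_apply (hKn.op_apply he')).of_le (le hqn))
    have v₄ : VanishesToOrder b (q + 1) X₄ :=
      heV.smul hb (hcn.of_le (le hqn)) (he'.of_le (le hqn))
    have h₁₂ := h₁.add h₂
    have h₁₂₃ := h₁₂.add hg'n
    have vX : VanishesToOrder b (q + 1) (fun s => X₁ s + X₂ s + X₃ s + X₄ s) :=
      ((((v₁.add hb v₂ (h₁.of_le (le hqn)) (h₂.of_le (le hqn))).add hb hg.2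
        (h₁₂.of_le (le hqn)) (hg'n.of_le (le hqn))).add hb v₄
        (h₁₂₃.of_le (le hqn)) (h₄.of_le (le hqn))))
    have hX := h₁₂₃.add h₄
    refine ⟨fun s => Complex.I • R s (X₁ s + X₂ s + X₃ s + X₄ s),
      longitudinalCorrection e (orthogonalCorrection H lam e (adiabaticCoeff H lam e (k + 1))),
      fun n' hn' => ?_, ?_, fun s hs => ?_⟩
    · obtain rfl : n' = n := by omega
      exact ⟨contDiffOn_const.smul (hRn.op_apply hX), hlong _ _ (by omega)⟩
    · exact (vX.op_apply_right hb (hRn.of_le (le hqn)) (hX.of_le (le hqn))).smul hb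
        contDiffOn_const ((hRn.op_apply hX).of_le (le hqn))
    · have hK' : derivWithin K (Icc 0 1) s = iteratedDerivWithin (k + 2) H (Icc 0 1) s  := by
        rw [iteratedDerivWithin_succ]
      have hS' : HasDerivWithinAt S (derivWithin S (Icc 0 1) s) (Icc 0 1) s :=
        hSs.hasDerivWithinAt_unitInterval hs
      have hder : HasDerivWithinAt (fun s => lamk • S s (K s (e s)) + g s + c s • e s) _
          (Icc 0 1) s :=
        (((hS'.op_apply ((hKs.hasDerivWithinAt_unitInterval hs).op_apply
          (he.hasDerivWithinAt_unitInterval hs))).const_smul lamk).add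
          (hgs.hasDerivWithinAt_unitInterval hs)).add
          ((hcs.hasDerivWithinAt_unitInterval hs).smul (he.hasDerivWithinAt_unitInterval hs))
      have hD : derivWithin (adiabaticCoeff H lam e (k + 1)) (Icc 0 1) s = _ :=
        (derivWithin_congr hu (hu s hs)).trans (derivWithin_unitInterval hs hder)
      have hRe : R s (e s) = 0 := (h.eigenpair s hs).reducedResolvent_self
      rw [adiabaticCoeff_succ, orthogonalCorrection, hD, hK']
      congr 1
      have hpow : ∀ x, (reducedResolvent (H s) (lam s) (e s) ^ (k + 1 + 2)) x = R s (S s x) :=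
        fun x => by rw [pow_succ', mul_apply_eq_comp]
      rw [hpow, show Complex.I ^ (k + 1 + 1) = Complex.I * Complex.I ^ (k + 1) by ring]
      change Complex.I • R s _ = _
      simp only [hX₁, hX₂, hX₄, map_add, map_smul, hRe, hlamk]
      module

/-- The value at `b` of the first coefficient that does not vanish there modulo `e`, and the
vanishing modulo `e` of the previous ones. -/
lemma exists_adiabaticCoeff_boundary (h : IsParallelEigenvector H lam e)
    (hH : ContDiffOn ℝ r H (Icc 0 1)) {b : ℝ} (hb : b ∈ Icc (0 : ℝ) 1) {m : ℕ} (hr : m + 1 ≤ r)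
    (hv : ∀ k, 1 ≤ k → k < m → iteratedDerivWithin k H (Icc 0 1) b = 0) {k : ℕ} (hk1 : 1 ≤ k)
    (hkm : k ≤ m) :
    ∃ c : ℂ, adiabaticCoeff H lam e k b =
      -(Complex.I ^ k) • (reducedResolvent (H b) (lam b) (e b) ^ (k + 1))
        (iteratedDerivWithin k H (Icc 0 1) b (e b)) + c • e b := by
  obtain ⟨k, rfl⟩ : ∃ k', k = k' + 1 := ⟨k - 1, by omega⟩
  obtain ⟨p, rfl⟩ : ∃ p, m = p + 1 := ⟨m - 1, by omega⟩
  have hv' : VanishesToOrder b p (derivWithin H (Icc 0 1)) := by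
    refine VanishesToOrder.of_iteratedDerivWithin fun i hi => ?_
    rw [← iteratedDerivWithin_succ']
    exact hv (i + 1) (by omega) (by omega)
  obtain ⟨g, c, -, hg, hu⟩ := h.exists_adiabaticCoeff_eq hH hb (by omega) hv'
    (show k ≤ p by omega)
  rw [show p + 1 - k = (p - k) + 1 by omega] at hg
  exact ⟨c b, by rw [hu b hb, hg.1, add_zero]⟩

/-- At `s = 0` all corrections are orthogonal to `e`, by the choice of the integration constants. -/
lemma inner_adiabaticCoeff_zero (h : IsParallelEigenvector H lam e) (k : ℕ) :
    inner ℂ (e 0) (adiabaticCoeff H lam e (k + 1) 0) = 0 := by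
  rw [adiabaticCoeff_succ, longitudinalCorrection, primitiveOn_zero, zero_smul, add_zero,
    h.inner_orthogonalCorrection _ (by simp)]

end IsParallelEigenvector

end Expansion

/-! ### Approximate solutions of the Schrödinger equation -/

section Stability

variable {E : Type*} [NormedAddCommGroup E] [InnerProductSpace ℂ E]

/-- `d` solves the Schrödinger equation with the source term `ρ` on `[0, 1]`. -/
def IsForcedSolution (H : ℝ → E →L[ℂ] E) (τ : ℝ) (ρ d : ℝ → E) : Prop :=
  ∀ s ∈ Icc (0 : ℝ) 1,
    HasDerivWithinAt d (-(Complex.I * (τ : ℂ)) • H s (d s) + ρ s) (Icc 0 1) s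

lemma IsSchrodingerSolution.isForcedSolution {H : ℝ → E →L[ℂ] E} {τ : ℝ} {ψ : ℝ → E}
    (h : IsSchrodingerSolution H τ ψ) : IsForcedSolution H τ (fun _ => 0) ψ :=
  fun s hs => by simpa using h s hs

namespace IsForcedSolution

variable {H : ℝ → E →L[ℂ] E} {τ : ℝ} {ρ ρ₁ ρ₂ d d₁ d₂ : ℝ → E}

lemma sub (h₁ : IsForcedSolution H τ ρ₁ d₁) (h₂ : IsForcedSolution H τ ρ₂ d₂) :
    IsForcedSolution H τ (fun s => ρ₁ s - ρ₂ s) (fun s => d₁ s - d₂ s) := fun s hs => by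
  refine HasDerivWithinAt.congr_deriv ((h₁ s hs).sub (h₂ s hs)) ?_
  rw [map_sub]
  module

lemma const_smul (c : ℂ) (h : IsForcedSolution H τ ρ d) :
    IsForcedSolution H τ (fun s => c • ρ s) (fun s => c • d s) := fun s hs => by
  refine HasDerivWithinAt.congr_deriv ((h s hs).const_smul c) ?_
  rw [map_smul]
  module

/-- The evolution generated by `H` alone does not change the norm. -/
lemma hasDerivWithinAt_inner_self (hH : ∀ s ∈ Icc (0 : ℝ) 1, (H s : E →ₗ[ℂ] E).IsSymmetric)
    (h : IsForcedSolution H τ ρ d) {s : ℝ} (hs : s ∈ Icc (0 : ℝ) 1) :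
    HasDerivWithinAt (fun s => inner ℂ (d s) (d s)) (inner ℂ (d s) (ρ s) + inner ℂ (ρ s) (d s))
      (Icc 0 1) s := by
  refine HasDerivWithinAt.congr_deriv ((h s hs).inner ℂ (h s hs)) ?_
  have h1 : inner ℂ (H s (d s)) (d s) = inner ℂ (d s) (H s (d s)) := hH s hs _ _
  simp only [inner_add_left, inner_add_right, inner_smul_left, inner_smul_right, h1, map_neg,
    map_mul, Complex.conj_I, Complex.conj_ofReal]
  ring

lemma norm_sq_sub_le (hH : ∀ s ∈ Icc (0 : ℝ) 1, (H s : E →ₗ[ℂ] E).IsSymmetric)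
    (h : IsForcedSolution H τ ρ d) {δ D : ℝ} (hδ : ∀ s ∈ Icc (0 : ℝ) 1, ‖ρ s‖ ≤ δ)
    (hD : ∀ s ∈ Icc (0 : ℝ) 1, ‖d s‖ ≤ D) {s : ℝ} (hs : s ∈ Icc (0 : ℝ) 1) :
    |‖d s‖ ^ 2 - ‖d 0‖ ^ 2| ≤ 2 * δ * D := by
  have h0 : (0 : ℝ) ∈ Icc (0 : ℝ) 1 := by simp
  have hδ0 : 0 ≤ δ := (norm_nonneg _).trans (hδ 0 h0)
  have hD0 : 0 ≤ D := (norm_nonneg _).trans (hD 0 h0)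
  have h1 := (convex_Icc (0 : ℝ) 1).norm_image_sub_le_of_norm_hasDerivWithin_le (C := 2 * δ * D)
    (fun t ht => h.hasDerivWithinAt_inner_self hH ht) (fun t ht => ?_) h0 hs
  · have h2 : inner ℂ (d s) (d s) - inner ℂ (d 0) (d 0) =
        ((‖d s‖ ^ 2 - ‖d 0‖ ^ 2 : ℝ) : ℂ) := by
      simp [inner_self_eq_norm_sq_to_K]
    rw [h2, Complex.norm_real, Real.norm_eq_abs] at h1
    refine h1.trans (mul_le_of_le_one_right (by positivity) ?_)
    rw [sub_zero, Real.norm_of_nonneg hs.1]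
    exact hs.2
  · have h3 := norm_inner_le_norm (𝕜 := ℂ) (d t) (ρ t)
    have h4 := norm_inner_le_norm (𝕜 := ℂ) (ρ t) (d t)
    have h5 : ‖d t‖ * ‖ρ t‖ ≤ D * δ :=
      mul_le_mul (hD t ht) (hδ t ht) (norm_nonneg _) hD0
    calc _ ≤ _ := norm_add_le _ _
      _ ≤ 2 * δ * D := by linarith

lemma continuousOn (h : IsForcedSolution H τ ρ d) : ContinuousOn d (Icc 0 1) :=
  fun s hs => (h s hs).continuousWithinAt

lemma norm_le (hH : ∀ s ∈ Icc (0 : ℝ) 1, (H s : E →ₗ[ℂ] E).IsSymmetric)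
    (h : IsForcedSolution H τ ρ d) {δ : ℝ} (hδ : ∀ s ∈ Icc (0 : ℝ) 1, ‖ρ s‖ ≤ δ)
    {s : ℝ} (hs : s ∈ Icc (0 : ℝ) 1) : ‖d s‖ ≤ ‖d 0‖ + 2 * δ := by
  have h0 : (0 : ℝ) ∈ Icc (0 : ℝ) 1 := by simp
  obtain ⟨t, ht, hmax⟩ := isCompact_Icc.exists_isMaxOn ⟨0, h0⟩ h.continuousOn.norm
  have hD : ∀ s ∈ Icc (0 : ℝ) 1, ‖d s‖ ≤ ‖d t‖ := fun s hs => hmax hs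
  have h1 := (le_abs_self _).trans (h.norm_sq_sub_le hH hδ hD ht)
  have hδ0 : 0 ≤ δ := (norm_nonneg _).trans (hδ 0 h0)
  have h2 := hD 0 h0
  refine (hD s hs).trans ?_
  by_contra! h3
  nlinarith [norm_nonneg (d 0), norm_nonneg (d t)]

end IsForcedSolution

lemma IsSchrodingerSolution.norm_eq {H : ℝ → E →L[ℂ] E} {τ : ℝ} {ψ : ℝ → E}
    (hH : ∀ s ∈ Icc (0 : ℝ) 1, (H s : E →ₗ[ℂ] E).IsSymmetric)
    (h : IsSchrodingerSolution H τ ψ) {s : ℝ} (hs : s ∈ Icc (0 : ℝ) 1) : ‖ψ s‖ = ‖ψ 0‖ := by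
  have h1 := h.isForcedSolution.norm_sq_sub_le hH (δ := 0) (by simp)
    (fun t ht => h.isForcedSolution.norm_le hH (δ := 0) (by simp) ht) hs
  rw [mul_zero, zero_mul, abs_nonpos_iff, sub_eq_zero] at h1
  exact (sq_eq_sq₀ (norm_nonneg _) (norm_nonneg _)).1 h1

/-- The dynamical phase accumulated by a level of energy `lam`. -/
noncomputable def dynamicalPhase (lam : ℝ → ℝ) (τ s : ℝ) : ℂ :=
  Complex.exp (-(Complex.I * τ) * (primitiveOn lam s : ℝ))

lemma dynamicalPhase_zero (lam : ℝ → ℝ) (τ : ℝ) : dynamicalPhase lam τ 0 = 1 := by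
  simp [dynamicalPhase, primitiveOn_zero]

lemma norm_dynamicalPhase (lam : ℝ → ℝ) (τ s : ℝ) : ‖dynamicalPhase lam τ s‖ = 1 := by
  rw [dynamicalPhase, show -(Complex.I * (τ : ℂ)) * (primitiveOn lam s : ℝ) =
    ((-(τ * primitiveOn lam s) : ℝ) : ℂ) * Complex.I by push_cast; ring,
    Complex.norm_exp_ofReal_mul_I]

lemma hasDerivWithinAt_dynamicalPhase {lam : ℝ → ℝ} (hlam : ContinuousOn lam (Icc 0 1)) (τ : ℝ)
    {s : ℝ} (hs : s ∈ Icc (0 : ℝ) 1) :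
    HasDerivWithinAt (dynamicalPhase lam τ)
      (dynamicalPhase lam τ s * (-(Complex.I * τ) * lam s)) (Icc 0 1) s :=
  ((hasDerivWithinAt_primitiveOn hlam hs).ofReal_comp.const_mul _).cexp

/-- Overlap of a forced solution with a test vector `z` that solves, up to `η`, the homogeneous
equation for `H - lam`. -/
lemma IsForcedSolution.norm_inner_le {H : ℝ → E →L[ℂ] E} {τ : ℝ} {ρ d : ℝ → E}
    (hH : ∀ s ∈ Icc (0 : ℝ) 1, (H s : E →ₗ[ℂ] E).IsSymmetric)
    (h : IsForcedSolution H τ ρ d) {lam : ℝ → ℝ} (hlam : ContinuousOn lam (Icc 0 1))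
    {z z' : ℝ → E} (hz : ∀ s ∈ Icc (0 : ℝ) 1, HasDerivWithinAt z (z' s) (Icc 0 1) s)
    {η Z δ D : ℝ}
    (hη : ∀ s ∈ Icc (0 : ℝ) 1,
      ‖z' s + (Complex.I * (τ : ℂ)) • (H s (z s) - (lam s : ℂ) • z s)‖ ≤ η)
    (hZ : ∀ s ∈ Icc (0 : ℝ) 1, ‖z s‖ ≤ Z) (hδ : ∀ s ∈ Icc (0 : ℝ) 1, ‖ρ s‖ ≤ δ)
    (hD : ∀ s ∈ Icc (0 : ℝ) 1, ‖d s‖ ≤ D) :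
    ‖inner ℂ (z 1) (d 1)‖ ≤ ‖inner ℂ (z 0) (d 0)‖ + (η * D + Z * δ) := by
  have h0 : (0 : ℝ) ∈ Icc (0 : ℝ) 1 := by simp
  have h1 : (1 : ℝ) ∈ Icc (0 : ℝ) 1 := by simp
  have hη0 : 0 ≤ η := (norm_nonneg _).trans (hη 0 h0)
  have hZ0 : 0 ≤ Z := (norm_nonneg _).trans (hZ 0 h0)
  have hθ : ∀ s ∈ Icc (0 : ℝ) 1, HasDerivWithinAt (fun s => dynamicalPhase lam (-τ) s) _
      (Icc 0 1) s := fun s hs => hasDerivWithinAt_dynamicalPhase hlam (-τ) hs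
  have key := (convex_Icc (0 : ℝ) 1).norm_image_sub_le_of_norm_hasDerivWithin_le
    (f := fun s => dynamicalPhase lam (-τ) s * inner ℂ (z s) (d s)) (C := η * D + Z * δ)
    (fun s hs => (hθ s hs).mul ((hz s hs).inner ℂ (h s hs))) (fun s hs => ?_) h0 h1
  · have h2 := norm_sub_norm_le (dynamicalPhase lam (-τ) 1 * inner ℂ (z 1) (d 1))
      (dynamicalPhase lam (-τ) 0 * inner ℂ (z 0) (d 0))
    rw [norm_mul, norm_mul, norm_dynamicalPhase, norm_dynamicalPhase] at h2
    simp only [sub_zero, norm_one, mul_one] at key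
    linarith
  · have hs1 : inner ℂ (z s) (H s (d s)) = inner ℂ (H s (z s)) (d s) := (hH s hs _ _).symm
    have h3 : dynamicalPhase lam (-τ) s * (-(Complex.I * ((-τ : ℝ) : ℂ)) * lam s) *
        inner ℂ (z s) (d s) + dynamicalPhase lam (-τ) s *
        (inner ℂ (z s) (-(Complex.I * (τ : ℂ)) • H s (d s) + ρ s) + inner ℂ (z' s) (d s)) =
        dynamicalPhase lam (-τ) s *
          (inner ℂ (z' s + (Complex.I * (τ : ℂ)) • (H s (z s) - (lam s : ℂ) • z s)) (d s) +
            inner ℂ (z s) (ρ s)) := by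
      simp only [inner_add_left, inner_add_right, inner_sub_left, inner_smul_left,
        inner_smul_right, hs1, map_mul, Complex.conj_I, Complex.conj_ofReal]
      push_cast
      ring
    rw [h3, norm_mul, norm_dynamicalPhase, one_mul]
    refine (norm_add_le _ _).trans (add_le_add ?_ ?_)
    · exact (norm_inner_le_norm _ _).trans (mul_le_mul (hη s hs) (hD s hs) (norm_nonneg _) hη0)
    · exact (norm_inner_le_norm _ _).trans (mul_le_mul (hZ s hs) (hδ s hs) (norm_nonneg _) hZ0)

lemma exists_norm_le_on_unitInterval {F : Type*} [NormedAddCommGroup F] {f : ℝ → F}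
    (hf : ContinuousOn f (Icc 0 1)) : ∃ B : ℝ, 0 ≤ B ∧ ∀ s ∈ Icc (0 : ℝ) 1, ‖f s‖ ≤ B := by
  obtain ⟨B, hB⟩ := isCompact_Icc.exists_bound_of_continuousOn hf
  exact ⟨B, (norm_nonneg _).trans (hB 0 (by simp)), hB⟩

/-- First order adiabatic theorem for one level: if `e' = (H - lam) y` with `y` of class `C¹`, the
modulus of the amplitude in the level `e` changes by `O(1 / τ)`. The test vector is
`e + (i / τ) y`, the start of the adiabatic expansion at `e`. -/
lemma exists_norm_inner_le {H : ℝ → E →L[ℂ] E}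
    (hH : ∀ s ∈ Icc (0 : ℝ) 1, (H s : E →ₗ[ℂ] E).IsSymmetric) {lam : ℝ → ℝ}
    (hlam : ContinuousOn lam (Icc 0 1)) {e y : ℝ → E} (he : DifferentiableOn ℝ e (Icc 0 1))
    (heig : ∀ s ∈ Icc (0 : ℝ) 1, H s (e s) = (lam s : ℂ) • e s)
    (hy : ContDiffOn ℝ (0 + 1 : ℕ) y (Icc 0 1))
    (hey : ∀ s ∈ Icc (0 : ℝ) 1, H s (y s) - (lam s : ℂ) • y s = derivWithin e (Icc 0 1) s) :
    ∃ C : ℝ, 0 ≤ C ∧ ∀ (τ : ℝ) (ρ d : ℝ → E) (δ D : ℝ), 1 ≤ τ → IsForcedSolution H τ ρ d →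
      (∀ s ∈ Icc (0 : ℝ) 1, ‖ρ s‖ ≤ δ) → (∀ s ∈ Icc (0 : ℝ) 1, ‖d s‖ ≤ D) →
      ‖inner ℂ (e 1) (d 1)‖ ≤ ‖inner ℂ (e 0) (d 0)‖ + C * (D / τ + δ) := by
  obtain ⟨B, hB0, hB⟩ := exists_norm_le_on_unitInterval he.continuousOn
  obtain ⟨Y, hY0, hY⟩ := exists_norm_le_on_unitInterval hy.continuousOn
  obtain ⟨Y', hY'0, hY'⟩ := exists_norm_le_on_unitInterval hy.derivWithin_unitInterval.continuousOn
  refine ⟨B + 3 * Y + Y', by positivity, fun τ ρ d δ D hτ h hδ hD => ?_⟩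
  have h0 : (0 : ℝ) ∈ Icc (0 : ℝ) 1 := by simp
  have h1 : (1 : ℝ) ∈ Icc (0 : ℝ) 1 := by simp
  have hτ0 : (0 : ℝ) < τ := by linarith
  have hδ0 : 0 ≤ δ := (norm_nonneg _).trans (hδ 0 h0)
  have hD0 : 0 ≤ D := (norm_nonneg _).trans (hD 0 h0)
  have hτC : (τ : ℂ) ≠ 0 := by exact_mod_cast hτ0.ne'
  set a : ℂ := Complex.I / τ with ha
  have hna : ‖a‖ = 1 / τ := by
    rw [ha, norm_div, Complex.norm_I, Complex.norm_real, Real.norm_of_nonneg hτ0.le]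
  have ha1 : ‖a‖ ≤ 1 := by rw [hna, div_le_one hτ0]; exact hτ
  have key := h.norm_inner_le hH hlam (z := fun s => e s + a • y s)
    (z' := fun s => derivWithin e (Icc 0 1) s + a • derivWithin y (Icc 0 1) s)
    (fun s hs => (he s hs).hasDerivWithinAt.add
      ((hy.hasDerivWithinAt_unitInterval hs).const_smul a))
    (η := Y' / τ) (Z := B + Y) (fun s hs => ?_) (fun s hs => ?_) hδ hD
  · have hay : ∀ s ∈ Icc (0 : ℝ) 1, ‖inner ℂ (a • y s) (d s)‖ ≤ Y * (D / τ) := fun s hs => by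
      rw [inner_smul_left, norm_mul, RCLike.norm_conj, hna]
      calc 1 / τ * ‖inner ℂ (y s) (d s)‖ ≤ 1 / τ * (Y * D) := by
            gcongr
            exact (norm_inner_le_norm _ _).trans
              (mul_le_mul (hY s hs) (hD s hs) (norm_nonneg _) hY0)
        _ = Y * (D / τ) := by ring
    have e1 : inner ℂ (e 1) (d 1) = inner ℂ (e 1 + a • y 1) (d 1) - inner ℂ (a • y 1) (d 1) := by
      rw [inner_add_left]; ring
    have e2 : ‖inner ℂ (e 0 + a • y 0) (d 0)‖ ≤ ‖inner ℂ (e 0) (d 0)‖ + Y * (D / τ) := by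
      rw [inner_add_left]
      exact (norm_add_le _ _).trans (by gcongr; exact hay 0 h0)
    rw [e1]
    refine (norm_sub_le _ _).trans ?_
    have e3 := hay 1 h1
    have e4 : Y' / τ * D = Y' * (D / τ) := by ring
    have e5 : 0 ≤ D / τ := by positivity
    rw [e4] at key
    nlinarith [mul_nonneg hB0 e5, mul_nonneg hY0 e5, mul_nonneg hY0 hδ0, mul_nonneg hY'0 hδ0]
  · have e1 : derivWithin e (Icc 0 1) s + a • derivWithin y (Icc 0 1) s +
        (Complex.I * (τ : ℂ)) • (H s (e s + a • y s) - (lam s : ℂ) • (e s + a • y s)) =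
        a • derivWithin y (Icc 0 1) s := by
      have e2 : H s (e s + a • y s) - (lam s : ℂ) • (e s + a • y s) =
          a • (H s (y s) - (lam s : ℂ) • y s) := by
        rw [map_add, map_smul, heig s hs]
        module
      have e3 : Complex.I * (τ : ℂ) * a = -1 := by
        rw [ha]
        field_simp
        exact Complex.I_sq
      rw [e2, hey s hs, smul_smul, e3]
      module
    rw [e1, norm_smul, hna, one_div, inv_mul_eq_div]
    gcongr
    exact hY' s hs
  · refine (norm_add_le _ _).trans (add_le_add (hB s hs) ?_)
    rw [norm_smul]
    exact (mul_le_of_le_one_left (norm_nonneg _) ha1).trans (hY s hs)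

end Stability

/-! ### Coupling of the levels of an eigenframe -/

section Eigenframe

variable {E : Type*} [NormedAddCommGroup E] [InnerProductSpace ℂ E]
  {N : ℕ} {H : ℝ → E →L[ℂ] E} {e : Fin (N + 1) → ℝ → E} {ε : Fin (N + 1) → ℝ → ℝ}

open Classical in
/-- `⟨k| H' |j⟩ / (ε j - ε k) ^ n` if the levels `j` and `k` never meet on `[0, 1]`, and `0`
otherwise. -/
noncomputable def levelCoupling (H : ℝ → E →L[ℂ] E) (e : Fin (N + 1) → ℝ → E)
    (ε : Fin (N + 1) → ℝ → ℝ) (j k : Fin (N + 1)) (n : ℕ) (s : ℝ) : ℂ :=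
  if ∀ t ∈ Icc (0 : ℝ) 1, ε j t ≠ ε k t then
    inner ℂ (e k s) (derivWithin H (Icc 0 1) s (e j s)) / ((ε j s : ℂ) - (ε k s : ℂ)) ^ n
  else 0

namespace IsInstantaneousEigenframe

lemma sum_inner_smul (h : IsInstantaneousEigenframe H e ε) [FiniteDimensional ℂ E]
    (hN : Module.finrank ℂ E = N + 1) {s : ℝ} (hs : s ∈ Icc (0 : ℝ) 1) (x : E) :
    ∑ k, inner ℂ (e k s) x • e k s = x := by
  have hon := h.orthonormal s hs
  have hspan := hon.linearIndependent.span_eq_top_of_card_eq_finrank' (by simp [hN])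
  have := (OrthonormalBasis.mk hon hspan.ge).sum_repr' x
  simpa using this

lemma norm_eq (h : IsInstantaneousEigenframe H e ε) (j : Fin (N + 1)) {s : ℝ}
    (hs : s ∈ Icc (0 : ℝ) 1) : ‖e j s‖ = 1 := (h.orthonormal s hs).1 j

lemma derivWithin_eq_sum (h : IsInstantaneousEigenframe H e ε) [FiniteDimensional ℂ E]
    (hN : Module.finrank ℂ E = N + 1)
    (hsymm : ∀ s ∈ Icc (0 : ℝ) 1, (H s : E →ₗ[ℂ] E).IsSymmetric)
    (hH : DifferentiableOn ℝ H (Icc 0 1)) (j : Fin (N + 1)) {s : ℝ} (hs : s ∈ Icc (0 : ℝ) 1) :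
    derivWithin (e j) (Icc 0 1) s = ∑ k, levelCoupling H e ε j k 1 s • e k s := by
  conv_lhs => rw [← h.sum_inner_smul hN hs (derivWithin (e j) (Icc 0 1) s)]
  refine Finset.sum_congr rfl fun k _ => ?_
  congr 1
  unfold levelCoupling
  split_ifs with hjk
  · have hne : k ≠ j := fun hkj => hjk 0 (by simp) (by rw [hkj])
    have h1 := map_derivWithin_eigenvector hH (differentiableOn_eigenvalue hH (h.differentiable j)
      (fun s hs => h.norm_eq j hs) fun s hs => h.eigen s hs j) (h.differentiable j)
      (fun s hs => h.eigen s hs j) hs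
    have h2 := congrArg (inner ℂ (e k s)) h1
    have h3 : inner ℂ (e k s) (H s (derivWithin (e j) (Icc 0 1) s)) =
      inner ℂ (H s (e k s)) (derivWithin (e j) (Icc 0 1) s) := (hsymm s hs _ _).symm
    rw [inner_sub_right, inner_sub_right, h3, h.eigen s hs, inner_smul_left, inner_smul_right,
      inner_smul_right, (h.orthonormal s hs).2 hne, Complex.conj_ofReal] at h2
    have h4 : (ε j s : ℂ) - (ε k s : ℂ) ≠ 0 := by
      rw [sub_ne_zero]; exact_mod_cast hjk s hs
    rw [pow_one, eq_div_iff h4]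
    linear_combination -h2
  · by_cases hkj : k = j
    · rw [hkj]; exact h.phase s hs j
    · exact ((h.noncrossing k j hkj).resolve_left
        fun hc => hjk fun t ht => (hc t ht).symm) s hs

lemma contDiffOn_levelCoupling (h : IsInstantaneousEigenframe H e ε) {n : ℕ}
    (hH : ContDiffOn ℝ (n + 1 : ℕ) H (Icc 0 1)) (he : ∀ j, ContDiffOn ℝ n (e j) (Icc 0 1))
    (j k : Fin (N + 1)) (p : ℕ) :
    ContDiffOn ℝ n (levelCoupling H e ε j k p) (Icc 0 1) := by
  unfold levelCoupling
  split_ifs with hjk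
  · have hε : ∀ j, ContDiffOn ℝ n (fun s => (ε j s : ℂ)) (Icc 0 1) := fun j =>
      Complex.ofRealCLM.contDiff.comp_contDiffOn (contDiffOn_eigenvalue
        (hH.of_le (by exact_mod_cast n.le_succ)) (he j) (fun s hs => h.norm_eq j hs)
        fun s hs => h.eigen s hs j)
    simp only [div_eq_mul_inv]
    refine ((he k).inner ℂ (hH.derivWithin_unitInterval.op_apply (he j))).mul
      ((((hε j).sub (hε k)).pow p).inv fun s hs => pow_ne_zero p ?_)
    rw [sub_ne_zero]
    exact_mod_cast hjk s hs
  · exact contDiffOn_const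

lemma contDiffOn_one (h : IsInstantaneousEigenframe H e ε) [FiniteDimensional ℂ E]
    (hN : Module.finrank ℂ E = N + 1)
    (hsymm : ∀ s ∈ Icc (0 : ℝ) 1, (H s : E →ₗ[ℂ] E).IsSymmetric)
    (hH : ContDiffOn ℝ (0 + 1 : ℕ) H (Icc 0 1)) (j : Fin (N + 1)) :
    ContDiffOn ℝ (0 + 1 : ℕ) (e j) (Icc 0 1) := by
  have he : ∀ j, ContDiffOn ℝ (0 : ℕ) (e j) (Icc 0 1) := fun j => by
    exact_mod_cast contDiffOn_zero.2 (h.differentiable j).continuousOn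
  refine contDiffOn_succ_of_hasDerivWithinAt
    (fun s hs => ((h.differentiable j) s hs).hasDerivWithinAt) ?_
  have h1 : ContDiffOn ℝ (0 : ℕ) (fun s => ∑ k, levelCoupling H e ε j k 1 s • e k s) (Icc 0 1) :=
    ContDiffOn.sum fun k _ => (h.contDiffOn_levelCoupling hH he j k 1).smul (he k)
  refine h1.congr fun s hs => ?_
  exact h.derivWithin_eq_sum hN hsymm (hH.differentiableOn (by simp)) j hs

/-- The levels coupled to `j` stay away from it, so `H - ε j` can be inverted on the derivative of
the eigenvector `j`, although the eigenvalue `ε j` may be degenerate. -/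
lemma exists_map_sub_eq_derivWithin (h : IsInstantaneousEigenframe H e ε) [FiniteDimensional ℂ E]
    (hN : Module.finrank ℂ E = N + 1)
    (hsymm : ∀ s ∈ Icc (0 : ℝ) 1, (H s : E →ₗ[ℂ] E).IsSymmetric)
    (hH : ContDiffOn ℝ (0 + 1 + 1 : ℕ) H (Icc 0 1)) (j : Fin (N + 1)) :
    ∃ y : ℝ → E, ContDiffOn ℝ (0 + 1 : ℕ) y (Icc 0 1) ∧ ∀ s ∈ Icc (0 : ℝ) 1,
      H s (y s) - (ε j s : ℂ) • y s = derivWithin (e j) (Icc 0 1) s := by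
  have he := h.contDiffOn_one hN hsymm (hH.of_le (by norm_num))
  refine ⟨fun s => ∑ k, -levelCoupling H e ε j k 2 s • e k s, ContDiffOn.sum fun k _ =>
    (h.contDiffOn_levelCoupling hH he j k 2).neg.smul (he k), fun s hs => ?_⟩
  rw [h.derivWithin_eq_sum hN hsymm (hH.differentiableOn (by simp)) j hs, map_sum,
    Finset.smul_sum, ← Finset.sum_sub_distrib]
  refine Finset.sum_congr rfl fun k _ => ?_
  rw [map_smul, h.eigen s hs, smul_smul, smul_smul, ← sub_smul]
  congr 1
  unfold levelCoupling
  split_ifs with hjk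
  · have h4 : (ε j s : ℂ) - (ε k s : ℂ) ≠ 0 := by
      rw [sub_ne_zero]; exact_mod_cast hjk s hs
    field_simp
    ring
  · simp

/-- The ground state of an eigenframe is a parallel eigenvector. -/
lemma isParallelEigenvector (h : IsInstantaneousEigenframe H e ε) [FiniteDimensional ℂ E]
    (hN : Module.finrank ℂ E = N + 1)
    (hsymm : ∀ s ∈ Icc (0 : ℝ) 1, (H s : E →ₗ[ℂ] E).IsSymmetric) :
    IsParallelEigenvector H (ε 0) (e 0) where
  eigenpair s hs :=
    { symm := hsymm s hs
      norm_eq := h.norm_eq 0 hs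
      eigen := h.eigen s hs 0
      simple := fun x hx => by
        conv_lhs => rw [← h.sum_inner_smul hN hs x]
        refine Finset.sum_eq_single 0 (fun k _ hk => ?_) (by simp)
        have h1 : inner ℂ (e k s) (H s x) = inner ℂ (H s (e k s)) x := (hsymm s hs _ _).symm
        rw [hx, h.eigen s hs, inner_smul_left, inner_smul_right, Complex.conj_ofReal,
          ← sub_eq_zero, ← sub_mul, mul_eq_zero] at h1
        have h2 : (ε 0 s : ℂ) - (ε k s : ℂ) ≠ 0 := by
          rw [sub_ne_zero]; exact_mod_cast (h.ground_lt s hs k hk).ne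
        rw [h1.resolve_left h2, zero_smul] }
  differentiable := h.differentiable 0
  parallel s hs := h.phase s hs 0

end IsInstantaneousEigenframe

end Eigenframe

/-! ### Transition amplitudes of adiabatic evolutions -/

section AdiabaticApproximation

variable {E : Type*} [NormedAddCommGroup E] [InnerProductSpace ℂ E]

/-- The adiabatic expansion truncated after the order `τ⁻ⁿ`. -/
noncomputable def adiabaticApprox (H : ℝ → E →L[ℂ] E) (lam : ℝ → ℝ) (e : ℝ → E) (τ : ℝ) (n : ℕ)
    (s : ℝ) : E :=
  dynamicalPhase lam τ s • ∑ k ∈ Finset.range (n + 1), ((τ : ℂ)⁻¹) ^ k • adiabaticCoeff H lam e k s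

/-- The squared norm of the component of `x` orthogonal to `e` is at most the squared distance
from `x` to any multiple of `e`. -/
lemma norm_sq_sub_norm_inner_sq_le {e : E} (he : ‖e‖ = 1) (x : E) (c : ℂ) :
    ‖x‖ ^ 2 - ‖inner ℂ e x‖ ^ 2 ≤ ‖x - c • e‖ ^ 2 := by
  have h1 := norm_sub_sq (𝕜 := ℂ) x (c • e)
  have h2 : RCLike.re (inner ℂ x (c • e)) ≤ ‖c‖ * ‖inner ℂ e x‖ := by
    rw [inner_smul_right, ← norm_inner_symm x e, ← norm_mul]
    exact RCLike.re_le_norm _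
  rw [norm_smul, he, mul_one] at h1
  nlinarith [sq_nonneg (‖c‖ - ‖inner ℂ e x‖)]

lemma norm_ofReal_inv_pow {τ : ℝ} (hτ : 1 ≤ τ) (k : ℕ) : ‖((τ : ℂ)⁻¹) ^ k‖ = 1 / τ ^ k := by
  rw [norm_pow, norm_inv, Complex.norm_real, Real.norm_of_nonneg (by linarith), inv_pow, one_div]

namespace IsParallelEigenvector

variable [FiniteDimensional ℂ E] {H : ℝ → E →L[ℂ] E} {lam : ℝ → ℝ} {e : ℝ → E} {r : ℕ}

/-- The truncated expansion misses the Schrödinger equation by a term of order `τ⁻ⁿ`: the source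
terms of consecutive orders cancel. -/
lemma isForcedSolution_adiabaticApprox (h : IsParallelEigenvector H lam e)
    (hH : ContDiffOn ℝ r H (Icc 0 1)) {τ : ℝ} (hτ : 1 ≤ τ) {n : ℕ} (hn : n < r) :
    IsForcedSolution H τ (fun s => (dynamicalPhase lam τ s * ((τ : ℂ)⁻¹) ^ n) •
      derivWithin (adiabaticCoeff H lam e n) (Icc 0 1) s) (adiabaticApprox H lam e τ n) := by
  intro s hs
  have hlam : ContinuousOn lam (Icc 0 1) := (h.contDiffOn_lam hH (h.contDiffOn hH)).continuousOn
  have hθ := hasDerivWithinAt_dynamicalPhase hlam τ hs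
  have hτC : (τ : ℂ) ≠ 0 := by
    have : τ ≠ 0 := by linarith
    exact_mod_cast this
  have hu : ∀ k < r, HasDerivWithinAt (adiabaticCoeff H lam e k)
      (derivWithin (adiabaticCoeff H lam e k) (Icc 0 1) s) (Icc 0 1) s := fun k hk =>
    (h.contDiffOn_adiabaticCoeff hH (n := r - k - 1 + 1) (k := k)
      (by omega)).hasDerivWithinAt_unitInterval hs
  induction n with
  | zero =>
    have h1 : adiabaticApprox H lam e τ 0 =
        fun s => dynamicalPhase lam τ s • adiabaticCoeff H lam e 0 s := by
      funext s; simp [adiabaticApprox]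
    rw [h1]
    refine (hθ.smul (hu 0 hn)).congr_deriv ?_
    have h2 : H s (adiabaticCoeff H lam e 0 s) = (lam s : ℂ) • adiabaticCoeff H lam e 0 s :=
      (h.eigenpair s hs).eigen
    simp only [map_smul, h2, pow_zero, mul_one]
    module
  | succ n ih =>
    have h1 : adiabaticApprox H lam e τ (n + 1) = fun s => adiabaticApprox H lam e τ n s +
        dynamicalPhase lam τ s • ((τ : ℂ)⁻¹) ^ (n + 1) • adiabaticCoeff H lam e (n + 1) s := by
      funext s
      rw [adiabaticApprox, Finset.sum_range_succ, smul_add, ← adiabaticApprox]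
    rw [h1]
    refine ((ih (by omega)).add (hθ.smul ((hu (n + 1) hn).const_smul _))).congr_deriv ?_
    have h2 := h.map_adiabaticCoeff_succ hH (show n < r by omega) hs
    rw [sub_eq_iff_eq_add] at h2
    simp only [map_add, map_smul, h2, smul_add, smul_smul]
    have h3 : -(Complex.I * (τ : ℂ)) * (dynamicalPhase lam τ s * (τ : ℂ)⁻¹ ^ (n + 1) *
        Complex.I) = dynamicalPhase lam τ s * (τ : ℂ)⁻¹ ^ n := by
      rw [pow_succ]
      have : (τ : ℂ) * (τ : ℂ)⁻¹ = 1 := mul_inv_cancel₀ hτC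
      linear_combination (-dynamicalPhase lam τ s * (τ : ℂ)⁻¹ ^ n * Complex.I ^ 2) * this -
        dynamicalPhase lam τ s * (τ : ℂ)⁻¹ ^ n * Complex.I_sq
    simp only [h3, Pi.smul_apply]
    module

/-- Below the order `m` the adiabatic expansion reduces to `e` at `s = 0`. -/
lemma sum_adiabaticCoeff_zero (h : IsParallelEigenvector H lam e)
    (hH : ContDiffOn ℝ r H (Icc 0 1)) {m : ℕ} (hm : 1 ≤ m) (hr : m + 1 ≤ r)
    (hv : ∀ k, 1 ≤ k → k < m → iteratedDerivWithin k H (Icc 0 1) 0 = 0) (a : ℂ) :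
    ∑ k ∈ Finset.range m, a ^ k • adiabaticCoeff H lam e k 0 = e 0 := by
  rw [Finset.sum_eq_single_of_mem 0 (Finset.mem_range.2 hm)]
  · simp [adiabaticCoeff]
  · intro k hk hk0
    have hkm := Finset.mem_range.1 hk
    obtain ⟨c, hc⟩ := h.exists_adiabaticCoeff_boundary hH (b := 0) (by simp) hr hv
      (show 1 ≤ k by omega) hkm.le
    rw [hv k (by omega) hkm, zero_apply, map_zero, smul_zero, zero_add] at hc
    obtain ⟨k, rfl⟩ : ∃ k', k = k' + 1 := ⟨k - 1, by omega⟩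
    have h1 := h.inner_adiabaticCoeff_zero k
    rw [hc, inner_smul_right, (h.eigenpair 0 (by simp)).inner_self_eq, mul_one] at h1
    rw [hc, h1, zero_smul, smul_zero]

/-- Below the order `m` the adiabatic expansion is a multiple of `e` at `s = 1`. -/
lemma exists_sum_adiabaticCoeff_one (h : IsParallelEigenvector H lam e)
    (hH : ContDiffOn ℝ r H (Icc 0 1)) {m : ℕ} (hr : m + 1 ≤ r)
    (hv : ∀ k, 1 ≤ k → k < m → iteratedDerivWithin k H (Icc 0 1) 1 = 0) (a : ℂ) :
    ∃ c : ℂ, ∑ k ∈ Finset.range m, a ^ k • adiabaticCoeff H lam e k 1 = c • e 1 := by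
  have h1 : ∀ k ∈ Finset.range m, ∃ c : ℂ, a ^ k • adiabaticCoeff H lam e k 1 = c • e 1 := by
    intro k hk
    have hkm := Finset.mem_range.1 hk
    rcases Nat.eq_zero_or_pos k with rfl | hk0
    · exact ⟨1, by simp [adiabaticCoeff]⟩
    · obtain ⟨c, hc⟩ := h.exists_adiabaticCoeff_boundary hH (b := 1) (by simp) hr hv hk0 hkm.le
      rw [hv k hk0 hkm, zero_apply, map_zero, smul_zero, zero_add] at hc
      exact ⟨a ^ k * c, by rw [hc, smul_smul]⟩
  choose! c hc using h1
  exact ⟨∑ k ∈ Finset.range m, c k, by rw [Finset.sum_smul, Finset.sum_congr rfl hc]⟩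

/-- If the derivatives of `H` of orders `1, …, m - 1` vanish at both end points, then the
probability to leave the eigenvector `e` is `O(τ⁻²ᵐ)`. -/
theorem exists_excitation_le (h : IsParallelEigenvector H lam e) {m : ℕ} (hm : 1 ≤ m)
    (hH : ContDiffOn ℝ (m + 1 : ℕ) H (Icc 0 1))
    (hv0 : ∀ k, 1 ≤ k → k < m → iteratedDerivWithin k H (Icc 0 1) 0 = 0)
    (hv1 : ∀ k, 1 ≤ k → k < m → iteratedDerivWithin k H (Icc 0 1) 1 = 0) :
    ∃ C : ℝ, ∀ τ : ℝ, 1 ≤ τ → ∀ (ψ : ℝ → E) (z : ℂ), ‖z‖ = 1 → IsSchrodingerSolution H τ ψ →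
      ψ 0 = z • e 0 → 1 - ‖inner ℂ (e 1) (ψ 1)‖ ^ 2 ≤ C / τ ^ (2 * m) := by
  have hsymm : ∀ s ∈ Icc (0 : ℝ) 1, (H s : E →ₗ[ℂ] E).IsSymmetric :=
    fun s hs => (h.eigenpair s hs).symm
  have h1 : (1 : ℝ) ∈ Icc (0 : ℝ) 1 := by simp
  have hum := h.contDiffOn_adiabaticCoeff hH (n := 0 + 1) (k := m) (by omega)
  obtain ⟨B, hB0, hB⟩ := exists_norm_le_on_unitInterval hum.derivWithin_unitInterval.continuousOn
  set u := adiabaticCoeff H lam e m with hu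
  refine ⟨(‖u 0‖ + 2 * B + ‖u 1‖) ^ 2, fun τ hτ ψ z hz hψ hψ0 => ?_⟩
  have hτ0 : (0 : ℝ) < τ := by linarith
  set χ := adiabaticApprox H lam e τ m with hχ
  set a : ℂ := (τ : ℂ)⁻¹ with ha
  have hd := hψ.isForcedSolution.sub
    ((h.isForcedSolution_adiabaticApprox hH hτ (Nat.lt_succ_self m)).const_smul z)
  have hbound := hd.norm_le hsymm (δ := B / τ ^ m) (fun s hs => ?_) h1
  · obtain ⟨c, hc⟩ := h.exists_sum_adiabaticCoeff_one hH le_rfl hv1 a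
    have hχ0 : ψ 0 - z • χ 0 = -(z * a ^ m) • u 0 := by
      rw [hψ0, hχ, adiabaticApprox, Finset.sum_range_succ,
        h.sum_adiabaticCoeff_zero hH hm le_rfl hv0, dynamicalPhase_zero]
      module
    have hχ1 : χ 1 = (dynamicalPhase lam τ 1 * c) • e 1 +
        (dynamicalPhase lam τ 1 * a ^ m) • u 1 := by
      rw [hχ, adiabaticApprox, Finset.sum_range_succ, hc]
      module
    have hn0 : ‖ψ 0 - z • χ 0‖ = ‖u 0‖ / τ ^ m := by
      rw [hχ0, norm_smul, norm_neg, norm_mul, hz, norm_ofReal_inv_pow hτ]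
      ring
    have hψn : ‖ψ 1‖ = 1 := by
      rw [hψ.norm_eq hsymm h1, hψ0, norm_smul, hz, (h.eigenpair 0 (by simp)).norm_eq, one_mul]
    have key := norm_sq_sub_norm_inner_sq_le (h.eigenpair 1 h1).norm_eq (ψ 1)
      (z * (dynamicalPhase lam τ 1 * c))
    rw [hψn, one_pow] at key
    refine key.trans ?_
    rw [pow_mul', ← div_pow]
    refine pow_le_pow_left₀ (norm_nonneg _) ?_ 2
    have hsplit : ψ 1 - (z * (dynamicalPhase lam τ 1 * c)) • e 1 =
        (ψ 1 - z • χ 1) + (z * (dynamicalPhase lam τ 1 * a ^ m)) • u 1 := by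
      rw [hχ1]
      module
    rw [hsplit]
    refine (norm_add_le _ _).trans ?_
    rw [hn0] at hbound
    have hn1 : ‖(z * (dynamicalPhase lam τ 1 * a ^ m)) • u 1‖ = ‖u 1‖ / τ ^ m := by
      rw [norm_smul, norm_mul, norm_mul, hz, norm_dynamicalPhase, norm_ofReal_inv_pow hτ]
      ring
    rw [hn1, add_div, add_div, mul_div_assoc]
    gcongr
  · rw [zero_sub, norm_neg, norm_smul, hz, one_mul, norm_smul, norm_mul, norm_dynamicalPhase,
      norm_ofReal_inv_pow hτ, one_mul, one_div, inv_mul_eq_div]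
    gcongr
    exact hB s hs

end IsParallelEigenvector

namespace IsInstantaneousEigenframe

variable [FiniteDimensional ℂ E] {N : ℕ} {H : ℝ → E →L[ℂ] E} {e : Fin (N + 1) → ℝ → E}
  {ε : Fin (N + 1) → ℝ → ℝ}

/-- The leading coefficient of the amplitude in the level `j` at an end point. -/
lemma norm_inner_adiabaticCoeff (h : IsInstantaneousEigenframe H e ε)
    (hN : Module.finrank ℂ E = N + 1)
    (hsymm : ∀ s ∈ Icc (0 : ℝ) 1, (H s : E →ₗ[ℂ] E).IsSymmetric) {m r : ℕ} (hm : 1 ≤ m)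
    (hr : m + 1 ≤ r) (hH : ContDiffOn ℝ r H (Icc 0 1)) {b : ℝ} (hb : b ∈ Icc (0 : ℝ) 1)
    (hv : ∀ k, 1 ≤ k → k < m → iteratedDerivWithin k H (Icc 0 1) b = 0) {j : Fin (N + 1)}
    (hj : j ≠ 0) :
    ‖inner ℂ (e j b) (adiabaticCoeff H (ε 0) (e 0) m b)‖ = ‖excitationCoeff H e ε m j b‖ := by
  have hp := h.isParallelEigenvector hN hsymm
  obtain ⟨c, hc⟩ := hp.exists_adiabaticCoeff_boundary hH hb hr hv hm le_rfl
  have horth : inner ℂ (e j b) (e 0 b) = 0 := (h.orthonormal b hb).2 hj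
  rw [hc, inner_add_right, inner_smul_right, inner_smul_right, horth, mul_zero, add_zero,
    (hp.eigenpair b hb).inner_reducedResolvent_pow (h.eigen b hb j) (h.ground_lt b hb j hj).ne'
      horth, norm_mul, norm_neg, norm_pow, Complex.norm_I, one_pow, one_mul, excitationCoeff]

/-- The amplitude in an excited level `j` at the end of the evolution. Besides the terms of order
`τ⁻ᵐ` of the expansion at `s = 1`, it contains the contribution of the initial mismatch between the
expansion and the ground state; the modulus of the component of this mismatch along the level `j`
is conserved up to `O(τ⁻ᵐ⁻¹)`, because the levels coupled to `j` are separated from it. -/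
lemma exists_norm_inner_le (h : IsInstantaneousEigenframe H e ε)
    (hN : Module.finrank ℂ E = N + 1)
    (hsymm : ∀ s ∈ Icc (0 : ℝ) 1, (H s : E →ₗ[ℂ] E).IsSymmetric) {m : ℕ} (hm : 1 ≤ m)
    (hH : ContDiffOn ℝ (m + 2 : ℕ) H (Icc 0 1))
    (hv0 : ∀ k, 1 ≤ k → k < m → iteratedDerivWithin k H (Icc 0 1) 0 = 0)
    (hv1 : ∀ k, 1 ≤ k → k < m → iteratedDerivWithin k H (Icc 0 1) 1 = 0) {j : Fin (N + 1)}
    (hj : j ≠ 0) :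
    ∃ C : ℝ, 0 ≤ C ∧ ∀ τ : ℝ, 1 ≤ τ → ∀ ψ : ℝ → E, IsSchrodingerSolution H τ ψ → ψ 0 = e 0 0 →
      ‖inner ℂ (e j 1) (ψ 1)‖ ≤
        (‖excitationCoeff H e ε m j 0‖ + ‖excitationCoeff H e ε m j 1‖) / τ ^ m +
          C / τ ^ (m + 1) := by
  have h0 : (0 : ℝ) ∈ Icc (0 : ℝ) 1 := by simp
  have h1 : (1 : ℝ) ∈ Icc (0 : ℝ) 1 := by simp
  have hp := h.isParallelEigenvector hN hsymm
  have hH2 : ContDiffOn ℝ (0 + 1 + 1 : ℕ) H (Icc 0 1) := hH.of_le (by exact_mod_cast (by omega))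
  have hej := h.contDiffOn_one hN hsymm (hH2.of_le (by norm_num)) j
  have hεj : ContinuousOn (ε j) (Icc 0 1) :=
    (contDiffOn_eigenvalue (hH2.of_le (by norm_num)) hej (fun s hs => h.norm_eq j hs)
      fun s hs => h.eigen s hs j).continuousOn
  obtain ⟨y, hy, hey⟩ := h.exists_map_sub_eq_derivWithin hN hsymm hH2 j
  obtain ⟨K, hK0, hK⟩ := _root_.exists_norm_inner_le hsymm hεj (h.differentiable j)
    (fun s hs => h.eigen s hs j) hy hey
  have hum := hp.contDiffOn_adiabaticCoeff hH (n := 0 + 1) (k := m + 1) (by omega)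
  obtain ⟨B, hB0, hB⟩ := exists_norm_le_on_unitInterval hum.derivWithin_unitInterval.continuousOn
  have hu0 := h.norm_inner_adiabaticCoeff hN hsymm hm (Nat.le_succ _) hH h0 hv0 hj
  have hu1 := h.norm_inner_adiabaticCoeff hN hsymm hm (Nat.le_succ _) hH h1 hv1 hj
  set u := adiabaticCoeff H (ε 0) (e 0) m with hu
  set w := adiabaticCoeff H (ε 0) (e 0) (m + 1) with hw
  refine ⟨‖w 0‖ + K * (‖u 0‖ + ‖w 0‖ + 3 * B) + ‖w 1‖, by positivity,
    fun τ hτ ψ hψ hψ0 => ?_⟩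
  have hτ0 : (0 : ℝ) < τ := by linarith
  set χ := adiabaticApprox H (ε 0) (e 0) τ (m + 1) with hχ
  set a : ℂ := (τ : ℂ)⁻¹ with ha
  have hd := hψ.isForcedSolution.sub
    (hp.isForcedSolution_adiabaticApprox hH hτ (n := m + 1) (by omega))
  have hδ : ∀ s ∈ Icc (0 : ℝ) 1, ‖0 - (dynamicalPhase (ε 0) τ s * ((τ : ℂ)⁻¹) ^ (m + 1)) •
      derivWithin w (Icc 0 1) s‖ ≤ B / τ ^ (m + 1) := fun s hs => by
    rw [zero_sub, norm_neg, norm_smul, norm_mul, norm_dynamicalPhase,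
      norm_ofReal_inv_pow hτ, one_mul, one_div, inv_mul_eq_div]
    gcongr
    exact hB s hs
  have hχ0 : ψ 0 - χ 0 = -(a ^ m • u 0 + a ^ (m + 1) • w 0) := by
    rw [hψ0, hχ, adiabaticApprox, Finset.sum_range_succ, Finset.sum_range_succ,
      hp.sum_adiabaticCoeff_zero hH hm (Nat.le_succ _) hv0, dynamicalPhase_zero]
    module
  have hpow : 1 / τ ^ (m + 1) ≤ 1 / τ ^ m :=
    one_div_le_one_div_of_le (by positivity) (pow_le_pow_right₀ hτ m.le_succ)
  have hD : ∀ s ∈ Icc (0 : ℝ) 1, ‖ψ s - χ s‖ ≤ (‖u 0‖ + ‖w 0‖ + 2 * B) / τ ^ m := fun s hs => by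
    refine (hd.norm_le hsymm hδ hs).trans ?_
    have h2 : ‖ψ 0 - χ 0‖ ≤ 1 / τ ^ m * ‖u 0‖ + 1 / τ ^ (m + 1) * ‖w 0‖ := by
      rw [hχ0, norm_neg]
      refine (norm_add_le _ _).trans_eq ?_
      rw [norm_smul, norm_smul, norm_ofReal_inv_pow hτ, norm_ofReal_inv_pow hτ]
    calc _ ≤ 1 / τ ^ m * ‖u 0‖ + 1 / τ ^ (m + 1) * ‖w 0‖ + 2 * (1 / τ ^ (m + 1) * B) := by
          rw [show B / τ ^ (m + 1) = 1 / τ ^ (m + 1) * B by ring]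
          gcongr
      _ ≤ 1 / τ ^ m * ‖u 0‖ + 1 / τ ^ m * ‖w 0‖ + 2 * (1 / τ ^ m * B) := by gcongr
      _ = _ := by ring
  have key := hK τ _ _ _ _ hτ hd hδ hD
  have hin0 : ‖inner ℂ (e j 0) (ψ 0 - χ 0)‖ ≤
      ‖excitationCoeff H e ε m j 0‖ / τ ^ m + ‖w 0‖ / τ ^ (m + 1) := by
    rw [hχ0, inner_neg_right, norm_neg, inner_add_right, inner_smul_right, inner_smul_right]
    refine (norm_add_le _ _).trans ?_
    rw [norm_mul, norm_mul, hu0, norm_ofReal_inv_pow hτ, norm_ofReal_inv_pow hτ, one_div,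
      inv_mul_eq_div, one_div, inv_mul_eq_div]
    gcongr
    simpa [h.norm_eq j h0] using norm_inner_le_norm (𝕜 := ℂ) (e j 0) (w 0)
  have hin1 : ‖inner ℂ (e j 1) (χ 1)‖ ≤
      ‖excitationCoeff H e ε m j 1‖ / τ ^ m + ‖w 1‖ / τ ^ (m + 1) := by
    obtain ⟨c, hc⟩ := hp.exists_sum_adiabaticCoeff_one hH (Nat.le_succ _) hv1 a
    rw [hχ, adiabaticApprox, Finset.sum_range_succ, Finset.sum_range_succ, hc, inner_smul_right,
      norm_mul, norm_dynamicalPhase, one_mul, inner_add_right, inner_add_right, inner_smul_right,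
      inner_smul_right, inner_smul_right, (h.orthonormal 1 h1).2 hj, mul_zero, zero_add]
    refine (norm_add_le _ _).trans ?_
    rw [norm_mul, norm_mul, hu1, norm_ofReal_inv_pow hτ, norm_ofReal_inv_pow hτ, one_div,
      inv_mul_eq_div, one_div, inv_mul_eq_div]
    gcongr
    simpa [h.norm_eq j h1] using norm_inner_le_norm (𝕜 := ℂ) (e j 1) (w 1)
  have hsplit : inner ℂ (e j 1) (ψ 1) = inner ℂ (e j 1) (ψ 1 - χ 1) + inner ℂ (e j 1) (χ 1) := by
    rw [← inner_add_right, sub_add_cancel]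
  rw [hsplit]
  refine (norm_add_le _ _).trans
    ((add_le_add (key.trans (add_le_add_left hin0 _)) hin1).trans_eq ?_)
  rw [div_div, ← pow_succ]
  ring

lemma exists_norm_inner_sq_le (h : IsInstantaneousEigenframe H e ε)
    (hN : Module.finrank ℂ E = N + 1)
    (hsymm : ∀ s ∈ Icc (0 : ℝ) 1, (H s : E →ₗ[ℂ] E).IsSymmetric) {m : ℕ} (hm : 1 ≤ m)
    (hH : ContDiffOn ℝ (m + 2 : ℕ) H (Icc 0 1))
    (hv0 : ∀ k, 1 ≤ k → k < m → iteratedDerivWithin k H (Icc 0 1) 0 = 0)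
    (hv1 : ∀ k, 1 ≤ k → k < m → iteratedDerivWithin k H (Icc 0 1) 1 = 0) {j : Fin (N + 1)}
    (hj : j ≠ 0) :
    ∃ C : ℝ, ∀ τ : ℝ, 1 ≤ τ → ∀ ψ : ℝ → E, IsSchrodingerSolution H τ ψ → ψ 0 = e 0 0 →
      ‖inner ℂ (e j 1) (ψ 1)‖ ^ 2 ≤
        1 / τ ^ (2 * m) *
          (‖excitationCoeff H e ε m j 0‖ + ‖excitationCoeff H e ε m j 1‖) ^ 2
        + C / τ ^ (2 * m + 1) := by
  obtain ⟨C, hC0, hC⟩ := h.exists_norm_inner_le hN hsymm hm hH hv0 hv1 hj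
  set A := ‖excitationCoeff H e ε m j 0‖ + ‖excitationCoeff H e ε m j 1‖ with hA
  have hA0 : 0 ≤ A := by positivity
  refine ⟨2 * A * C + C ^ 2, fun τ hτ ψ hψ hψ0 => ?_⟩
  have hτ0 : (0 : ℝ) < τ := by linarith
  refine (pow_le_pow_left₀ (norm_nonneg _) (hC τ hτ ψ hψ hψ0) 2).trans ?_
  have h1 : 1 / τ ^ (2 * m + 2) ≤ 1 / τ ^ (2 * m + 1) :=
    one_div_le_one_div_of_le (by positivity) (pow_le_pow_right₀ hτ (by omega))
  calc (A / τ ^ m + C / τ ^ (m + 1)) ^ 2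
      = 1 / τ ^ (2 * m) * A ^ 2 + 2 * A * C * (1 / τ ^ (2 * m + 1)) +
        C ^ 2 * (1 / τ ^ (2 * m + 2)) := by
        field_simp
        ring
    _ ≤ 1 / τ ^ (2 * m) * A ^ 2 + 2 * A * C * (1 / τ ^ (2 * m + 1)) +
        C ^ 2 * (1 / τ ^ (2 * m + 1)) := by gcongr
    _ = _ := by ring

end IsInstantaneousEigenframe

end AdiabaticApproximation

/-! ### Parallel transport of a nondegenerate ground state -/

section ParallelTransport

variable {E : Type*} [NormedAddCommGroup E] [InnerProductSpace ℂ E]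

open Metric in
/-- A linear differential equation with a continuous skew-adjoint generator has a global solution.
The linear field is multiplied by the factor `2 / (1 + ‖x‖²)`, which makes it bounded, so that the
Picard–Lindelöf theorem applies on the whole of `[0, 1]`; the norm is conserved nevertheless, and on
the unit sphere the factor is `1`. -/
lemma exists_unitary_transport [CompleteSpace E] [FiniteDimensional ℂ E] {K : ℝ → E →L[ℂ] E}
    (hK : ContinuousOn K (Icc 0 1))
    (hskew : ∀ s ∈ Icc (0 : ℝ) 1, ∀ x, inner ℂ x (K s x) + inner ℂ (K s x) x = 0)
    {x₀ : E} (hx₀ : ‖x₀‖ = 1) :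
    ∃ x : ℝ → E, x 0 = x₀ ∧ (∀ s ∈ Icc (0 : ℝ) 1, ‖x s‖ = 1) ∧
      ∀ s ∈ Icc (0 : ℝ) 1, HasDerivWithinAt x (K s (x s)) (Icc 0 1) s := by
  have : ProperSpace E := FiniteDimensional.proper_rclike ℂ E
  obtain ⟨M, hM0, hM⟩ := exists_norm_le_on_unitInterval hK
  set g : E → E := fun x => (2 * (1 + ‖x‖ ^ 2)⁻¹ : ℝ) • x with hg
  have hpos : ∀ x : E, 0 < 1 + ‖x‖ ^ 2 := fun x => by positivity
  have hgd : ContDiff ℝ 1 g :=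
    (contDiff_const.mul ((contDiff_const.add (contDiff_norm_sq ℂ)).inv fun x =>
      (hpos x).ne')).smul contDiff_id
  have hg1 : ∀ x, ‖g x‖ ≤ 1 := fun x => by
    have h1 : 0 ≤ 2 * (1 + ‖x‖ ^ 2)⁻¹ := by positivity
    rw [hg, norm_smul, Real.norm_of_nonneg h1, mul_assoc, inv_mul_eq_div, ← mul_div_assoc,
      div_le_one (hpos x)]
    nlinarith [sq_nonneg (‖x‖ - 1)]
  obtain ⟨Λ, hΛ⟩ := (hgd.contDiffOn (s := closedBall x₀ (M.toNNReal : ℝ))).exists_lipschitzOnWith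
    one_ne_zero (convex_closedBall _ _) (isCompact_closedBall _ _)
  have hPL : IsPicardLindelof (fun t x => K t (g x)) (tmin := 0) (tmax := 1) ⟨0, by simp⟩ x₀
      M.toNNReal 0 M.toNNReal (M.toNNReal * Λ) :=
    { lipschitzOnWith := fun t ht => LipschitzOnWith.of_dist_le_mul fun x hx y hy => by
        rw [dist_eq_norm, ← map_sub]
        refine ((K t).le_opNorm _).trans ?_
        rw [NNReal.coe_mul, Real.coe_toNNReal M hM0, mul_assoc, ← dist_eq_norm]
        exact mul_le_mul (hM t ht) (hΛ.dist_le_mul x hx y hy) dist_nonneg hM0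
      continuousOn := fun x _ => hK.clm_apply continuousOn_const
      norm_le := fun t ht x _ => by
        rw [Real.coe_toNNReal M hM0]
        exact ((K t).le_opNorm _).trans
          ((mul_le_mul (hM t ht) (hg1 x) (norm_nonneg _) hM0).trans_eq (mul_one M))
      mul_max_le := by simp }
  obtain ⟨x, hx0, hx⟩ := hPL.exists_eq_forall_mem_Icc_hasDerivWithinAt₀
  have hx0 : x 0 = x₀ := hx0
  have hnorm : ∀ s ∈ Icc (0 : ℝ) 1, ‖x s‖ = 1 := fun s hs => by
    have h1 := (convex_Icc (0 : ℝ) 1).norm_image_sub_le_of_norm_hasDerivWithin_le (C := 0)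
      (fun t ht => (hx t ht).inner ℂ (hx t ht)) (fun t ht => ?_) (by simp : (0 : ℝ) ∈ Icc 0 1) hs
    · rw [zero_mul, norm_le_zero_iff, sub_eq_zero, inner_self_eq_norm_sq_to_K,
        inner_self_eq_norm_sq_to_K, hx0, hx₀] at h1
      have h2 : ‖x s‖ ^ 2 = 1 ^ 2 := by exact_mod_cast h1
      exact (sq_eq_sq₀ (norm_nonneg _) zero_le_one).1 h2
    · have h2 : K t (g (x t)) = ((2 * (1 + ‖x t‖ ^ 2)⁻¹ : ℝ) : ℂ) • K t (x t) := by
        rw [hg, ← map_smul]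
        congr 1
      rw [h2, inner_smul_right, inner_smul_left, Complex.conj_ofReal, ← mul_add, hskew t ht,
        mul_zero, norm_zero]
  refine ⟨x, hx0, hnorm, fun s hs => ?_⟩
  have h1 : g (x s) = x s := by
    rw [hg]
    simp only [hnorm s hs]
    norm_num
  have h2 := hx s hs
  rwa [h1] at h2

lemma norm_rankOne_sub_rankOne_le {v w : E} (hv : ‖v‖ = 1) (hw : ‖w‖ = 1) :
    ‖InnerProductSpace.rankOne ℂ v v - InnerProductSpace.rankOne ℂ w w‖ ≤
      3 * ‖v - inner ℂ w v • w‖ := by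
  set a : ℂ := inner ℂ w v with ha
  set q := v - a • w with hq
  have hww : inner ℂ w w = (1 : ℂ) := by simp [inner_self_eq_norm_sq_to_K, hw]
  have hwq : inner ℂ w q = 0 := by
    rw [hq, inner_sub_right, inner_smul_right, hww, ← ha]
    ring
  have hsq : ‖a‖ ^ 2 + ‖q‖ ^ 2 = 1 := by
    have h1 : ‖a • w + q‖ ^ 2 = ‖a • w‖ ^ 2 + ‖q‖ ^ 2 := by
      rw [norm_add_sq (𝕜 := ℂ), inner_smul_left, hwq]
      simp
    rw [hq, add_sub_cancel, hv, norm_smul, hw, mul_one, ← hq] at h1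
    linarith
  have hsqC : (starRingEnd ℂ) a * a + (‖q‖ : ℂ) ^ 2 = 1 := by
    rw [Complex.conj_mul']
    exact_mod_cast hsq
  have hdec : InnerProductSpace.rankOne ℂ v v - InnerProductSpace.rankOne ℂ w w =
      InnerProductSpace.rankOne ℂ (a • w) q + InnerProductSpace.rankOne ℂ q v -
        ((‖q‖ : ℂ) ^ 2) • InnerProductSpace.rankOne ℂ w w := by
    ext x
    have hvx : inner ℂ v x = (starRingEnd ℂ) a * inner ℂ w x + inner ℂ q x := by
      rw [← inner_smul_left, ← inner_add_left, hq, add_sub_cancel]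
    have hv' : v = a • w + q := by rw [hq, add_sub_cancel]
    simp only [sub_apply, add_apply, smul_apply, InnerProductSpace.rankOne_apply]
    rw [hvx]
    nth_rewrite 1 [hv']
    refine sub_eq_zero.1 (Eq.trans
      (b := ((starRingEnd ℂ) a * a + (‖q‖ : ℂ) ^ 2 - 1) • inner ℂ w x • w) (by module) ?_)
    rw [hsqC, sub_self, zero_smul]
  have ha1 : ‖a‖ ≤ 1 := by nlinarith [norm_nonneg a, sq_nonneg ‖q‖]
  have hq1 : ‖q‖ ≤ 1 := by nlinarith [norm_nonneg q, sq_nonneg ‖a‖]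
  rw [hdec]
  refine (norm_sub_le _ _).trans ((add_le_add_left (norm_add_le _ _) _).trans ?_)
  rw [norm_smul, InnerProductSpace.norm_rankOne, InnerProductSpace.norm_rankOne,
    InnerProductSpace.norm_rankOne, norm_smul, hw, hv, norm_pow, Complex.norm_real, norm_norm]
  nlinarith [norm_nonneg q]

variable {H : ℝ → E →L[ℂ] E} {lam : ℝ → ℝ} {v : ℝ → E}

/-- The Feynman–Hellmann formula, proved without differentiability of the eigenvector. -/
lemma hasDerivWithinAt_simple_eigenvalue
    (hp : ∀ s ∈ Icc (0 : ℝ) 1, IsSimpleEigenpair (H s) (lam s) (v s))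
    (hP : ContinuousOn (fun s => InnerProductSpace.rankOne ℂ (v s) (v s)) (Icc 0 1))
    {t : ℝ} (ht : t ∈ Icc (0 : ℝ) 1) {H' : E →L[ℂ] E} (hH : HasDerivWithinAt H H' (Icc 0 1) t) :
    HasDerivWithinAt lam (inner ℂ (v t) (H' (v t))).re (Icc 0 1) t := by
  rw [hasDerivWithinAt_iff_tendsto_slope] at hH ⊢
  set l := nhdsWithin t (Icc 0 1 \ {t}) with hl
  have hPt : Filter.Tendsto (fun s => InnerProductSpace.rankOne ℂ (v s) (v s) (v t)) l
      (nhds (v t)) := by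
    have h1 := ((hP t ht).clm_apply (continuousWithinAt_const (b := v t))).tendsto
    simp only [InnerProductSpace.rankOne_apply, (hp t ht).inner_self_eq, one_smul] at h1 ⊢
    exact h1.mono_left (nhdsWithin_mono _ sdiff_subset)
  have hden : Filter.Tendsto (fun s => inner ℂ (v t)
      (InnerProductSpace.rankOne ℂ (v s) (v s) (v t))) l (nhds 1) := by
    have := (tendsto_const_nhds (x := v t)).inner (𝕜 := ℂ) hPt
    rwa [(hp t ht).inner_self_eq] at this
  have hnum : Filter.Tendsto (fun s => inner ℂ (v t)
      (slope H t s (InnerProductSpace.rankOne ℂ (v s) (v s) (v t)))) l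
      (nhds (inner ℂ (v t) (H' (v t)))) :=
    (tendsto_const_nhds (x := v t)).inner
      (((isBoundedBilinearMap_apply (𝕜 := ℂ) (E := E) (F := E)).continuous.tendsto
        (H', v t)).comp (Filter.Tendsto.prodMk_nhds hH hPt))
  have hquot := (Complex.continuous_re.tendsto _).comp (hnum.div hden one_ne_zero)
  rw [div_one] at hquot
  refine hquot.congr' ?_
  have hne := hden.eventually_ne one_ne_zero
  filter_upwards [hne, self_mem_nhdsWithin] with s hs hsI
  set y := InnerProductSpace.rankOne ℂ (v s) (v s) (v t) with hy
  have h1 : H s y = (lam s : ℂ) • y := by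
    rw [hy, InnerProductSpace.rankOne_apply, map_smul, (hp s hsI.1).eigen, smul_comm]
  have h2 : inner ℂ (v t) (H t y) = (lam t : ℂ) * inner ℂ (v t) y := by
    have h3 : inner ℂ (v t) (H t y) = inner ℂ (H t (v t)) y := ((hp t ht).symm _ _).symm
    rw [h3, (hp t ht).eigen, inner_smul_left, Complex.conj_ofReal]
  have h4 : inner ℂ (v t) (slope H t s y) = ((slope lam t s : ℝ) : ℂ) * inner ℂ (v t) y := by
    have h5 : slope H t s y = (((s - t)⁻¹ : ℝ) : ℂ) • (H s y - H t y) := rfl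
    rw [h5, inner_smul_right, inner_sub_right, h1, h2, inner_smul_right, slope_def_field]
    push_cast
    ring
  simp only [Function.comp_apply, Pi.div_apply]
  rw [h4, mul_div_cancel_right₀ _ hs, Complex.ofReal_re]

variable [FiniteDimensional ℂ E]

/-- The spectral projector of a continuous simple eigenvalue is continuous. -/
lemma continuousOn_rankOne_eigenvector (hH : ContinuousOn H (Icc 0 1))
    (hlam : ContinuousOn lam (Icc 0 1))
    (hp : ∀ s ∈ Icc (0 : ℝ) 1, IsSimpleEigenpair (H s) (lam s) (v s)) :
    ContinuousOn (fun s => InnerProductSpace.rankOne ℂ (v s) (v s)) (Icc 0 1) := by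
  intro t ht
  set R := reducedResolvent (H t) (lam t) (v t) with hR
  have hlim : Filter.Tendsto (fun s => 3 * (‖R‖ * (‖H s - H t‖ + |lam s - lam t|)))
      (nhdsWithin t (Icc 0 1)) (nhds 0) := by
    have h1 : Filter.Tendsto (fun s => ‖H s - H t‖) (nhdsWithin t (Icc 0 1)) (nhds 0) :=
      tendsto_iff_norm_sub_tendsto_zero.1 (hH t ht)
    have h2 : Filter.Tendsto (fun s => |lam s - lam t|) (nhdsWithin t (Icc 0 1)) (nhds 0) :=
      tendsto_iff_norm_sub_tendsto_zero.1 (hlam t ht)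
    simpa using ((h1.add h2).const_mul ‖R‖).const_mul 3
  refine tendsto_iff_norm_sub_tendsto_zero.2 (squeeze_zero' (.of_forall fun _ => norm_nonneg _)
    ?_ hlim)
  filter_upwards [self_mem_nhdsWithin] with s hs
  refine (norm_rankOne_sub_rankOne_le (hp s hs).norm_eq (hp t ht).norm_eq).trans ?_
  gcongr
  rw [← (hp t ht).reducedResolvent_map (v s)]
  refine (R.le_opNorm _).trans ?_
  gcongr
  have h1 : H t (v s) - (lam t : ℂ) • v s =
      ((lam s - lam t : ℝ) : ℂ) • v s - (H s - H t) (v s) := by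
    rw [sub_apply, (hp s hs).eigen]
    push_cast
    module
  rw [h1, add_comm]
  refine (norm_sub_le _ _).trans (add_le_add ?_ ?_)
  · rw [norm_smul, (hp s hs).norm_eq, mul_one, Complex.norm_real, Real.norm_eq_abs]
  · simpa [(hp s hs).norm_eq] using (H s - H t).le_opNorm (v s)

/-- A continuous simple eigenvalue of a `C¹` family of self-adjoint operators has a global
parallel eigenvector. -/
lemma exists_isParallelEigenvector (hH : ContDiffOn ℝ (0 + 1 : ℕ) H (Icc 0 1))
    (hlam : ContinuousOn lam (Icc 0 1))
    (hp : ∀ s ∈ Icc (0 : ℝ) 1, IsSimpleEigenpair (H s) (lam s) (v s)) :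
    ∃ e : ℝ → E, IsParallelEigenvector H lam e := by
  have : CompleteSpace E := FiniteDimensional.complete ℂ E
  have hP := continuousOn_rankOne_eigenvector hH.continuousOn hlam hp
  set P : ℝ → E →L[ℂ] E := fun s => InnerProductSpace.rankOne ℂ (v s) (v s) with hPdef
  set R : ℝ → E →L[ℂ] E := fun s => reducedResolvent (H s) (lam s) (v s) with hRdef
  have hR : ContinuousOn R (Icc 0 1) :=
    (contDiffOn_reducedResolvent (n := 0) (contDiffOn_zero.2 hH.continuousOn)
      (contDiffOn_zero.2 hlam) (contDiffOn_zero.2 hP) hp).continuousOn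
  set H' := derivWithin H (Icc 0 1) with hH'def
  have hH' : ContinuousOn H' (Icc 0 1) := hH.derivWithin_unitInterval.continuousOn
  set μ' : ℝ → ℝ := fun s => (inner ℂ (v s) (H' s (v s))).re with hμ'def
  have hlam' : ∀ s ∈ Icc (0 : ℝ) 1, HasDerivWithinAt lam (μ' s) (Icc 0 1) s := fun s hs =>
    hasDerivWithinAt_simple_eigenvalue hp hP hs (hH.hasDerivWithinAt_unitInterval hs)
  have hH'symm : ∀ s ∈ Icc (0 : ℝ) 1, ∀ x y, inner ℂ (H' s x) y = inner ℂ x (H' s y) := by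
    intro s hs x y
    have hd := hH.hasDerivWithinAt_unitInterval hs
    have hc : ∀ z : E, HasDerivWithinAt (fun t => H t z) (H' s z) (Icc 0 1) s := fun z => by
      simpa using hd.op_apply (hasDerivWithinAt_const s (Icc 0 1) z)
    have h1 := (hc x).inner ℂ (hasDerivWithinAt_const s (Icc 0 1) y)
    have h2 := (hasDerivWithinAt_const s (Icc 0 1) x).inner ℂ (hc y)
    have hsymm : ∀ t ∈ Icc (0 : ℝ) 1, inner ℂ x (H t y) = inner ℂ (H t x) y :=
      fun t ht => ((hp t ht).symm x y).symm
    have h3 := derivWithin_unitInterval hs (h1.congr hsymm (hsymm s hs))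
    rw [derivWithin_unitInterval hs h2] at h3
    simpa using h3.symm
  have hPsymm : ∀ s x y, inner ℂ (P s x) y = inner ℂ x (P s y) := fun s x y => by
    simp [hPdef, mul_comm]
  have hRsymm : ∀ s ∈ Icc (0 : ℝ) 1, ∀ x y, inner ℂ (R s x) y = inner ℂ x (R s y) :=
    fun s hs => (hp s hs).inner_reducedResolvent_comm
  -- Kato's generator `[P', P]`, written in terms of the reduced resolvent
  obtain ⟨x, hx0, hx1, hx⟩ := exists_unitary_transport
    (K := fun s => P s * H' s * R s - R s * H' s * P s)
    (((hP.mul hH').mul hR).sub ((hR.mul hH').mul hP)) (fun s hs x => by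
      simp only [sub_apply, mul_apply_eq_comp, inner_sub_left, inner_sub_right]
      rw [hPsymm, hH'symm s hs, hRsymm s hs, hRsymm s hs, hH'symm s hs, hPsymm]
      ring) (hp 0 (by simp)).norm_eq
  set y : ℝ → E := fun s => H s (x s) - (lam s : ℂ) • x s with hydef
  have hRy : ∀ s ∈ Icc (0 : ℝ) 1, R s (y s) = x s - P s (x s) := fun s hs =>
    (hp s hs).reducedResolvent_map (x s)
  have hPHP : ∀ s ∈ Icc (0 : ℝ) 1, ∀ z, P s (H' s (P s z)) = (μ' s : ℂ) • P s z := by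
    intro s hs z
    have h1 : inner ℂ (v s) (H' s (v s)) = (μ' s : ℂ) := by
      refine (Complex.conj_eq_iff_re.1 ?_).symm
      rw [inner_conj_symm, hH'symm s hs]
    simp only [hPdef, InnerProductSpace.rankOne_apply, map_smul, h1]
    module
  -- the defect `y` of the eigenvalue equation solves a homogeneous linear equation
  have hy : ∀ s ∈ Icc (0 : ℝ) 1,
      HasDerivWithinAt y (H' s (R s (y s)) - (μ' s : ℂ) • R s (y s)) (Icc 0 1) s := by
    intro s hs
    have hd : HasDerivWithinAt y _ (Icc 0 1) s :=
      ((hH.hasDerivWithinAt_unitInterval hs).op_apply (hx s hs)).sub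
        (((hlam' s hs).ofReal_comp).smul (hx s hs))
    refine hd.congr_deriv ?_
    have hPeig : ∀ z, H s (P s z) = (lam s : ℂ) • P s z := fun z => by
      simp only [hPdef, InnerProductSpace.rankOne_apply, map_smul, (hp s hs).eigen]
      module
    have hHR : ∀ z, H s (R s z) = (lam s : ℂ) • R s z + (z - P s z) := fun z => by
      rw [← sub_eq_iff_eq_add']
      exact (hp s hs).map_reducedResolvent z
    rw [hRy s hs]
    simp only [sub_apply, mul_apply_eq_comp, map_sub, hPeig, hHR, hPHP s hs]
    module
  have hy0 : ∀ s ∈ Icc (0 : ℝ) 1, y s = 0 := by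
    obtain ⟨B, hB0, hB⟩ := exists_norm_le_on_unitInterval (hH'.mul hR)
    obtain ⟨B₂, hB₂0, hB₂⟩ := exists_norm_le_on_unitInterval hR
    obtain ⟨B₁, hB₁0, hB₁⟩ := exists_norm_le_on_unitInterval hH'
    refine eq_zero_of_abs_deriv_le_mul_abs_self_of_eq_zero_right (K := B + B₁ * B₂)
      (fun s hs => (hy s hs).continuousWithinAt)
      (fun s hs => (hy s (Ico_subset_Icc_self hs)).mono_of_mem_nhdsWithin
        (Icc_mem_nhdsGE_of_mem hs)) ?_ fun s hs => ?_
    · rw [hydef]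
      simp only [hx0, (hp 0 (by simp)).eigen, sub_self]
    · have hs := Ico_subset_Icc_self hs
      have h1 : ‖(μ' s : ℂ)‖ ≤ B₁ := by
        rw [Complex.norm_real, Real.norm_eq_abs]
        refine (Complex.abs_re_le_norm _).trans ((norm_inner_le_norm _ _).trans ?_)
        rw [(hp s hs).norm_eq, one_mul]
        exact ((H' s).le_opNorm _).trans (by rw [(hp s hs).norm_eq, mul_one]; exact hB₁ s hs)
      refine (norm_sub_le _ _).trans ?_
      rw [add_mul, norm_smul, mul_assoc B₁]
      refine add_le_add ?_ (mul_le_mul h1 ?_ (norm_nonneg _) hB₁0)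
      · exact ((H' s * R s).le_opNorm _).trans (by gcongr; exact hB s hs)
      · exact ((R s).le_opNorm _).trans (by gcongr; exact hB₂ s hs)
  have hxeig : ∀ s ∈ Icc (0 : ℝ) 1, H s (x s) = (lam s : ℂ) • x s := fun s hs =>
    sub_eq_zero.1 (hy0 s hs)
  have hPx : ∀ s ∈ Icc (0 : ℝ) 1, P s (x s) = x s := fun s hs => by
    have h1 := hRy s hs
    rw [hy0 s hs, map_zero, eq_comm, sub_eq_zero] at h1
    exact h1.symm
  refine ⟨x, fun s hs => ⟨(hp s hs).symm, hx1 s hs, hxeig s hs, fun z hz => ?_⟩,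
    fun s hs => (hx s hs).differentiableWithinAt, fun s hs => ?_⟩
  · have h1 := (hp s hs).simple z hz
    have h2 := (hp s hs).simple (x s) (hxeig s hs)
    set α := inner ℂ (v s) (x s) with hα
    have h3 : ‖α‖ = 1 := by
      have := hx1 s hs
      rwa [h2, norm_smul, (hp s hs).norm_eq, mul_one] at this
    have h4 : (starRingEnd ℂ) α * α = 1 := by rw [Complex.conj_mul', h3]; simp
    rw [h2, inner_smul_left, smul_smul, mul_right_comm, h4, one_mul]
    exact h1
  · rw [derivWithin_unitInterval hs (hx s hs)]
    simp only [sub_apply, mul_apply_eq_comp, inner_sub_right]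
    have hRx : R s (x s) = 0 := by
      rw [← hPx s hs]
      simp only [hPdef, hRdef, InnerProductSpace.rankOne_apply, map_smul,
        (hp s hs).reducedResolvent_self, smul_zero]
    rw [← hRsymm s hs (x s), hRx, map_zero, map_zero, inner_zero_right, inner_zero_left, sub_zero]

end ParallelTransport

/-! ### Ground states of self-adjoint operators -/

section GroundState

variable {E : Type*} [NormedAddCommGroup E] [InnerProductSpace ℂ E]

lemma IsGroundEnergy.unique {T : E →L[ℂ] E} {μ ν : ℝ} (hμ : IsGroundEnergy T μ)
    (hν : IsGroundEnergy T ν) : μ = ν :=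
  le_antisymm (hμ.2 ν hν.1) (hν.2 μ hμ.1)

/-- The lowest eigenvalue bounds the quadratic form from below. -/
lemma IsGroundEnergy.mul_norm_sq_le [FiniteDimensional ℂ E] {T : E →L[ℂ] E}
    (hT : (T : E →ₗ[ℂ] E).IsSymmetric) {μ : ℝ} (hμ : IsGroundEnergy T μ) (x : E) :
    μ * ‖x‖ ^ 2 ≤ (inner ℂ (T x) x).re := by
  rcases eq_or_ne x 0 with rfl | hx
  · simp
  have : Nontrivial E := ⟨x, 0, hx⟩
  have h1 := hμ.2 _ hT.hasEigenvalue_iInf_of_finiteDimensional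
  have hbdd : BddBelow (range fun x : { x : E // x ≠ 0 } =>
      RCLike.re (inner ℂ ((T : E →ₗ[ℂ] E) x) (x : E)) / ‖(x : E)‖ ^ 2) :=
    ⟨-‖T‖, by
      rintro _ ⟨y, rfl⟩
      exact (abs_le.1 (T.rayleighQuotient_le_norm (y : E))).1⟩
  have h2 := h1.trans (ciInf_le hbdd ⟨x, hx⟩)
  rwa [le_div_iff₀ (by positivity)] at h2

/-- By the variational principle, the lowest eigenvalue is a `1`-Lipschitz function of the
operator. -/
lemma IsGroundEnergy.sub_le_norm_sub [FiniteDimensional ℂ E] {S T : E →L[ℂ] E}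
    (hS : (S : E →ₗ[ℂ] E).IsSymmetric) {μ ν : ℝ} (hμ : IsGroundEnergy S μ)
    (hν : IsGroundEnergy T ν) : μ - ν ≤ ‖S - T‖ := by
  obtain ⟨v, hv⟩ := hν.1.exists_hasEigenvector
  have hTv : T v = (ν : ℂ) • v := hv.apply_eq_smul
  have hv0 : 0 < ‖v‖ ^ 2 := by
    have := norm_pos_iff.2 hv.2
    positivity
  have h1 := hμ.mul_norm_sq_le hS v
  have h2 : inner ℂ (S v) v = inner ℂ ((S - T) v) v + ((ν * ‖v‖ ^ 2 : ℝ) : ℂ) := by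
    rw [sub_apply, inner_sub_left, hTv, inner_smul_left, inner_self_eq_norm_sq_to_K,
      Complex.conj_ofReal]
    push_cast
    simp
  have h3 : (inner ℂ ((S - T) v) v).re ≤ ‖S - T‖ * ‖v‖ ^ 2 := by
    refine (Complex.re_le_norm _).trans ((norm_inner_le_norm _ _).trans ?_)
    rw [pow_two, ← mul_assoc]
    exact mul_le_mul_of_nonneg_right ((S - T).le_opNorm v) (norm_nonneg _)
  rw [h2, Complex.add_re, Complex.ofReal_re] at h1
  refine le_of_mul_le_mul_right ?_ hv0
  linarith

lemma HasNondegenerateGroundState.exists_isSimpleEigenpair {T : E →L[ℂ] E}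
    (hT : (T : E →ₗ[ℂ] E).IsSymmetric) (h : HasNondegenerateGroundState T) :
    ∃ (μ : ℝ) (v : E), IsGroundEnergy T μ ∧ IsSimpleEigenpair T μ v := by
  obtain ⟨μ, hμ, hrank⟩ := h
  obtain ⟨⟨w, hw⟩, hw0, hspan⟩ := finrank_eq_one_iff'.1 hrank
  have hw0 : w ≠ 0 := fun h => hw0 (Subtype.ext h)
  have hTw : T w = (μ : ℂ) • w := Module.End.mem_eigenspace_iff.1 hw
  have hn : (‖w‖ : ℂ) ≠ 0 := by simpa using hw0
  refine ⟨μ, (‖w‖ : ℂ)⁻¹ • w, hμ, hT, ?_, ?_, fun x hx => ?_⟩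
  · rw [norm_smul, norm_inv, Complex.norm_real, norm_norm, inv_mul_cancel₀ (norm_ne_zero_iff.2 hw0)]
  · rw [map_smul, hTw, smul_comm]
  · obtain ⟨c, hc⟩ := hspan ⟨x, Module.End.mem_eigenspace_iff.2 hx⟩
    have hc : c • w = x := congrArg Subtype.val hc
    rw [← hc, inner_smul_left, inner_smul_right, inner_self_eq_norm_sq_to_K, smul_smul]
    congr 1
    simp only [map_inv₀, Complex.conj_ofReal, Complex.coe_algebraMap]
    field_simp

lemma IsGroundState.exists_eq_smul {T : E →L[ℂ] E} {μ : ℝ} {v w : E}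
    (hμ : IsGroundEnergy T μ) (hv : IsSimpleEigenpair T μ v) (hw : IsGroundState T w) :
    ∃ z : ℂ, ‖z‖ = 1 ∧ w = z • v := by
  obtain ⟨hw1, ν, hν, hTw⟩ := hw
  rw [hν.unique hμ] at hTw
  have h1 := hv.simple w hTw
  refine ⟨inner ℂ v w, ?_, h1⟩
  rw [h1, norm_smul, hv.norm_eq, mul_one] at hw1
  exact hw1

/-- A `C¹` family of self-adjoint operators with nondegenerate ground states has a global parallel
ground state. -/
lemma exists_parallel_groundState [FiniteDimensional ℂ E] {H : ℝ → E →L[ℂ] E}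
    (hH : ContDiffOn ℝ (0 + 1 : ℕ) H (Icc 0 1))
    (hsymm : ∀ s ∈ Icc (0 : ℝ) 1, (H s : E →ₗ[ℂ] E).IsSymmetric)
    (hgs : ∀ s ∈ Icc (0 : ℝ) 1, HasNondegenerateGroundState (H s)) :
    ∃ (lam : ℝ → ℝ) (e : ℝ → E), IsParallelEigenvector H lam e ∧
      ∀ s ∈ Icc (0 : ℝ) 1, IsGroundEnergy (H s) (lam s) := by
  choose! lam v hlam hv using fun s hs => (hgs s hs).exists_isSimpleEigenpair (hsymm s hs)
  have hcont : ContinuousOn lam (Icc 0 1) := fun t ht => by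
    refine tendsto_iff_norm_sub_tendsto_zero.2 (squeeze_zero' (.of_forall fun _ => norm_nonneg _)
      ?_ (tendsto_iff_norm_sub_tendsto_zero.1 (hH.continuousOn t ht)))
    filter_upwards [self_mem_nhdsWithin] with s hs
    rw [Real.norm_eq_abs, abs_le]
    constructor
    · have := (hlam t ht).sub_le_norm_sub (hsymm t ht) (hlam s hs)
      rw [norm_sub_rev] at this
      linarith
    · exact (hlam s hs).sub_le_norm_sub (hsymm s hs) (hlam t ht)
  obtain ⟨e, he⟩ := exists_isParallelEigenvector hH hcont hv
  exact ⟨lam, e, he, hlam⟩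

end GroundState

/-! ### Annealing schedules -/

section Schedules

lemma iteratedDerivWithin_pow_mul_eval {b : ℝ} (hb : b ∈ Icc (0 : ℝ) 1) {k m : ℕ} (hkm : k < m)
    (q : Polynomial ℝ) :
    iteratedDerivWithin k (fun s => (s - b) ^ m * q.eval s) (Icc 0 1) b = 0 := by
  induction k generalizing m q with
  | zero => simp [Nat.pos_iff_ne_zero.1 hkm]
  | succ k ih =>
    obtain ⟨m, rfl⟩ : ∃ m', m = m' + 1 := ⟨m - 1, by omega⟩
    have h1 := ih (m := m) (by omega)
      (Polynomial.C ((m : ℝ) + 1) * q + (Polynomial.X - Polynomial.C b) * q.derivative)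
    rw [iteratedDerivWithin_succ']
    refine Eq.trans (iteratedDerivWithin_congr (fun s hs => ?_) hb) h1
    refine derivWithin_unitInterval hs ?_
    refine (((((hasDerivAt_id s).sub_const b).pow (m + 1)).mul
      (q.hasDerivAt s)).hasDerivWithinAt).congr_deriv ?_
    simp
    ring

/-- A function with derivative `c sᵖ (1 - s)ᵖ` is a schedule of order `p + 1`, if it has the right
end values. -/
lemma isAnnealingSchedule_of_hasDerivAt {p : ℕ} {c : ℝ} {f : ℝ → ℝ} (h0 : f 0 = 0) (h1 : f 1 = 1)
    (hf : ContDiff ℝ (p + 1 + 1 : ℕ) f) (hd : ∀ s, HasDerivAt f (c * (s ^ p * (1 - s) ^ p)) s) :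
    IsAnnealingSchedule (p + 1) f := by
  have key : ∀ (b : ℝ) (q : Polynomial ℝ), b ∈ Icc (0 : ℝ) 1 →
      (∀ s, c * (s ^ p * (1 - s) ^ p) = (s - b) ^ p * q.eval s) → ∀ k, 1 ≤ k → k < p + 1 →
      iteratedDerivWithin k f (Icc 0 1) b = 0 := by
    intro b q hb hq k hk hkp
    obtain ⟨k, rfl⟩ : ∃ k', k = k' + 1 := ⟨k - 1, by omega⟩
    rw [iteratedDerivWithin_succ']
    refine Eq.trans (iteratedDerivWithin_congr (fun s hs => ?_) hb)
      (iteratedDerivWithin_pow_mul_eval hb (show k < p by omega) q)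
    rw [← hq]
    exact derivWithin_unitInterval hs (hd s).hasDerivWithinAt
  refine ⟨h0, h1, hf.contDiffOn, key 0 (Polynomial.C c * (1 - Polynomial.X) ^ p) (by simp)
    fun s => ?_, key 1 (Polynomial.C c * Polynomial.X ^ p * (-1) ^ p) (by simp) fun s => ?_⟩
  · simp
    ring
  · rw [show (1 - s : ℝ) = (s - 1) * (-1) by ring, mul_pow]
    simp
    ring

variable {E : Type*} [NormedAddCommGroup E] [InnerProductSpace ℂ E]

lemma annealingHamiltonian_eq (f : ℝ → ℝ) (Hpot Hkin : E →L[ℂ] E) :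
    annealingHamiltonian f Hpot Hkin = fun s => Hkin + f s • (Hpot - Hkin) := by
  funext s
  ext x
  simp only [annealingHamiltonian, add_apply, smul_apply, sub_apply, ← Complex.coe_smul]
  push_cast
  module

lemma annealingHamiltonian_isSymmetric (f : ℝ → ℝ) {Hpot Hkin : E →L[ℂ] E}
    (hpot : (Hpot : E →ₗ[ℂ] E).IsSymmetric) (hkin : (Hkin : E →ₗ[ℂ] E).IsSymmetric) (s : ℝ) :
    (annealingHamiltonian f Hpot Hkin s : E →ₗ[ℂ] E).IsSymmetric :=
  (hpot.smul (Complex.conj_ofReal _)).add (hkin.smul (Complex.conj_ofReal _))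

lemma IsAnnealingSchedule.contDiffOn_hamiltonian {m : ℕ} {f : ℝ → ℝ}
    (hf : IsAnnealingSchedule m f) (Hpot Hkin : E →L[ℂ] E) :
    ContDiffOn ℝ (m + 1 : ℕ) (annealingHamiltonian f Hpot Hkin) (Icc 0 1) := by
  rw [annealingHamiltonian_eq]
  exact contDiffOn_const.add (hf.contDiffOn.smul contDiffOn_const)

lemma IsAnnealingSchedule.iteratedDerivWithin_hamiltonian {m : ℕ} {f : ℝ → ℝ}
    (hf : IsAnnealingSchedule m f) (Hpot Hkin : E →L[ℂ] E) {k : ℕ} (hk : 1 ≤ k) (hkm : k < m)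
    {b : ℝ} (hb : b ∈ Icc (0 : ℝ) 1) :
    iteratedDerivWithin k (annealingHamiltonian f Hpot Hkin) (Icc 0 1) b =
      iteratedDerivWithin k f (Icc 0 1) b • (Hpot - Hkin) := by
  rw [annealingHamiltonian_eq, iteratedDerivWithin_const_add hk]
  exact iteratedDerivWithin_smul_const hb uniqueDiffOn_unitInterval
    ((hf.contDiffOn.of_le (by exact_mod_cast (by omega))) b hb) _

lemma IsAnnealingSchedule.exists_excitation_le [FiniteDimensional ℂ E] {m : ℕ} (hm : 1 ≤ m)
    {Hpot Hkin : E →L[ℂ] E} {f : ℝ → ℝ} (hpot : (Hpot : E →ₗ[ℂ] E).IsSymmetric)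
    (hkin : (Hkin : E →ₗ[ℂ] E).IsSymmetric) (hf : IsAnnealingSchedule m f)
    (hgs : ∀ s ∈ Icc (0 : ℝ) 1, HasNondegenerateGroundState (annealingHamiltonian f Hpot Hkin s)) :
    ∃ C : ℝ, ∀ τ : ℝ, 1 ≤ τ → ∀ (ψ : ℝ → E) (g : E),
      IsSchrodingerSolution (annealingHamiltonian f Hpot Hkin) τ ψ →
      IsGroundState Hkin (ψ 0) → IsGroundState Hpot g →
        1 - ‖inner ℂ g (ψ 1)‖ ^ 2 ≤ C / τ ^ (2 * m) := by
  have hH := hf.contDiffOn_hamiltonian Hpot Hkin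
  obtain ⟨lam, e, he, hlam⟩ := exists_parallel_groundState
    (hH.of_le (by exact_mod_cast (by omega)))
    (fun s _ => annealingHamiltonian_isSymmetric f hpot hkin s) hgs
  have h0 : (0 : ℝ) ∈ Icc (0 : ℝ) 1 := by simp
  have h1 : (1 : ℝ) ∈ Icc (0 : ℝ) 1 := by simp
  obtain ⟨C, hC⟩ := he.exists_excitation_le hm hH
    (fun k hk hkm => by
      rw [hf.iteratedDerivWithin_hamiltonian _ _ hk hkm h0, hf.deriv_zero k hk hkm, zero_smul])
    (fun k hk hkm => by
      rw [hf.iteratedDerivWithin_hamiltonian _ _ hk hkm h1, hf.deriv_one k hk hkm, zero_smul])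
  have hH0 : annealingHamiltonian f Hpot Hkin 0 = Hkin := by
    simp [annealingHamiltonian, hf.zero]
  have hH1 : annealingHamiltonian f Hpot Hkin 1 = Hpot := by
    simp [annealingHamiltonian, hf.one]
  refine ⟨C, fun τ hτ ψ g hψ hψ0 hg => ?_⟩
  rw [← hH0] at hψ0
  rw [← hH1] at hg
  obtain ⟨z, hz, hz0⟩ := hψ0.exists_eq_smul (hlam 0 h0) (he.eigenpair 0 h0)
  obtain ⟨z', hz', rfl⟩ := hg.exists_eq_smul (hlam 1 h1) (he.eigenpair 1 h1)
  rw [inner_smul_left, norm_mul, RCLike.norm_conj, hz', one_mul]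
  exact hC τ hτ ψ z hz hψ hz0

end Schedules

/-! ### Adiabatic error bounds -/

theorem mainTheorem4 {E : Type*} [NormedAddCommGroup E] [InnerProductSpace ℂ E]
    [FiniteDimensional ℂ E] :
    -- the upper bound for a general time-dependent Hamiltonian
    (∀ (m N : ℕ), 1 ≤ m → Module.finrank ℂ E = N + 1 →
      ∀ (H : ℝ → E →L[ℂ] E) (e : Fin (N + 1) → ℝ → E) (ε : Fin (N + 1) → ℝ → ℝ),
        (∀ s ∈ Set.Icc (0 : ℝ) 1, (H s : E →ₗ[ℂ] E).IsSymmetric) →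
        ContDiffOn ℝ (m + 2 : ℕ) H (Set.Icc 0 1) →
        IsInstantaneousEigenframe H e ε →
        (∀ k, 1 ≤ k → k < m →
          iteratedDerivWithin k H (Set.Icc 0 1) 0 = 0 ∧
          iteratedDerivWithin k H (Set.Icc 0 1) 1 = 0) →
        ∃ C τ₀ : ℝ, 0 < τ₀ ∧ ∀ τ : ℝ, τ₀ ≤ τ → ∀ ψ : ℝ → E,
          IsSchrodingerSolution H τ ψ → ψ 0 = e 0 0 →
          ∀ j, j ≠ 0 →
            ‖inner ℂ (e j 1) (ψ 1)‖ ^ 2 ≤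
              1 / τ ^ (2 * m) *
                (‖excitationCoeff H e ε m j 0‖ + ‖excitationCoeff H e ε m j 1‖) ^ 2
              + C / τ ^ (2 * m + 1)) ∧
    -- annealing schedules with total excitation probability of order `τ ^ (-2 m)`
    (∀ (m : ℕ), 1 ≤ m → ∀ (Hpot Hkin : E →L[ℂ] E) (f : ℝ → ℝ),
        (Hpot : E →ₗ[ℂ] E).IsSymmetric → (Hkin : E →ₗ[ℂ] E).IsSymmetric →
        IsAnnealingSchedule m f →
        (∀ s ∈ Set.Icc (0 : ℝ) 1,
          HasNondegenerateGroundState (annealingHamiltonian f Hpot Hkin s)) →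
        ∃ C τ₀ : ℝ, 0 < τ₀ ∧ ∀ τ : ℝ, τ₀ ≤ τ → ∀ (ψ : ℝ → E) (g : E),
          IsSchrodingerSolution (annealingHamiltonian f Hpot Hkin) τ ψ →
          IsGroundState Hkin (ψ 0) → IsGroundState Hpot g →
            1 - ‖inner ℂ g (ψ 1)‖ ^ 2 ≤ C / τ ^ (2 * m)) ∧
    -- examples of such schedules, for `m = 1, 2, 3, 4`
    IsAnnealingSchedule 1 (fun s => s) ∧
    IsAnnealingSchedule 2 (fun s => s ^ 2 * (3 - 2 * s)) ∧
    IsAnnealingSchedule 3 (fun s => s ^ 3 * (10 - 15 * s + 6 * s ^ 2)) ∧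
    IsAnnealingSchedule 4 (fun s => s ^ 4 * (35 - 84 * s + 70 * s ^ 2 - 20 * s ^ 3)) := by
  refine ⟨fun m N hm hN H e ε hsymm hH hframe hv => ?_,
    fun m hm Hpot Hkin f hpot hkin hf hgs => ?_, ?_, ?_, ?_, ?_⟩
  · choose! C hC using fun (j : Fin (N + 1)) (hj : j ≠ 0) =>
      hframe.exists_norm_inner_sq_le hN hsymm hm hH (fun k hk hkm => (hv k hk hkm).1)
        (fun k hk hkm => (hv k hk hkm).2) hj
    refine ⟨∑ j, |C j|, 1, one_pos, fun τ hτ ψ hψ hψ0 j hj => (hC j hj τ hτ ψ hψ hψ0).trans ?_⟩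
    have hτ0 : (0 : ℝ) < τ := by linarith
    gcongr
    exact (le_abs_self _).trans
      (Finset.single_le_sum (f := fun j => |C j|) (fun i _ => abs_nonneg _) (Finset.mem_univ j))
  · obtain ⟨C, hC⟩ := hf.exists_excitation_le hm hpot hkin hgs
    exact ⟨C, 1, one_pos, hC⟩
  · refine isAnnealingSchedule_of_hasDerivAt (p := 0) (c := 1) rfl rfl contDiff_id fun s => ?_
    simpa using hasDerivAt_id' s
  · refine isAnnealingSchedule_of_hasDerivAt (p := 1) (c := 6) (by norm_num) (by norm_num)
      (by fun_prop) fun s => ?_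
    refine ((hasDerivAt_pow 2 s).mul (((hasDerivAt_id s).const_mul 2).const_sub 3)).congr_deriv ?_
    simp
    ring
  · refine isAnnealingSchedule_of_hasDerivAt (p := 2) (c := 30) (by norm_num) (by norm_num)
      (by fun_prop) fun s => ?_
    refine ((hasDerivAt_pow 3 s).mul ((((hasDerivAt_id s).const_mul 15).const_sub 10).add
      ((hasDerivAt_pow 2 s).const_mul 6))).congr_deriv ?_
    simp
    ring
  · refine isAnnealingSchedule_of_hasDerivAt (p := 3) (c := 140) (by norm_num) (by norm_num)
      (by fun_prop) fun s => ?_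
    refine ((hasDerivAt_pow 4 s).mul (((((hasDerivAt_id s).const_mul 84).const_sub 35).add
      ((hasDerivAt_pow 2 s).const_mul 70)).sub ((hasDerivAt_pow 3 s).const_mul 20))).congr_deriv ?_
    simp
    ring
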